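/- Let $k\ge 5$ be an integer and let $f\colon\mathbb{R}^k\to\mathbb{R}$ be a $C^\infty$ function whose Hessian determinant is non-zero at every point of $\mathbb{R}^k$. **Definitions.** A self-similar IFS on $\mathbb{R}^k$ is a finite family $\Lambda=\{f_i(x)=r_iO_ix+t_i\}_{1\le i\le N}$, $N>1$, with $r_i\in(0,1)$, $O_i\in O(k)$ orthogonal and $t_i\in\mathbb{R}^k$, such that the $f_i$ have no common fixed point. It is non-expanding if for every $\varepsilon>0$ there is a constant $C$ such that for all $n$ the set $\{O_{i_1}\cdots O_{i_n}: 1\le i_1,\dots,i_n\le N\}$ has at most $Ce^{\varepsilon n}$ elements. Its self-similar set is the unique non-empty compact $K$ with $K=\bigcup_i f_i(K)$; given weights $p_i\in(0,1)$ with $\sum_i p_i=1$, its self-similar measure is the unique Borel probability measure $\mu$ supported on $K$ with $\mu=\sum_i p_i\,(f_i)_*\mu$. A self-similar set or measure is non-expanding if it arises from at least one non-expanding self-similar IFS. A Borel probability measure $\mu$ on $\mathbb{R}^k$ is AD-regular if there are $s\ge 0$ and $C\ge 1$ with $C^{-1}r^s\le\mu(B_r(x))\le Cr^s$ for all $x\in\mathrm{supp}(\mu)$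 and $0<r\le 1$. Put $\widehat\mu(\xi)=\int e^{-2\pi i\langle\xi,x\rangle}\,d\mu(x)$ and $$\kappa_2(\mu)=\sup\Big\{0\le s<k:\ \exists\, C\ \ \forall R>0\ \ \int_{B(0,R)}|\widehat\mu(\xi)|^2\,d\xi\le C R^{k-s}\Big\}.$$ **Theorem.** (1) If $\mu$ is an AD-regular non-expanding self-similar measure on $\mathbb{R}^k$ with $\kappa_2(\mu)>2+\frac k2$, then the pushforward $\mu_f$ of $\mu$ under $f$ is absolutely continuous with respect to Lebesgue measure on $\mathbb{R}$, with a density in $L^2(\mathbb{R})$. (2) In particular, for every non-expanding self-similar set $E\subset\mathbb{R}^k$ with $\dim_{\mathrm H}E>2+\frac k2$, the image $f(E)$ has positive Lebesgue measure. -/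

import Mathlib

open MeasureTheory
open scoped ENNReal Pointwise ContDiff

/-- A finite subset `F` of a group is non-expanding if, for every `ε > 0`, the number of distinct
products of `n` elements of `F` is `O(exp (ε n))`. -/
def NonExpanding {G : Type*} [Group G] (F : Set G) : Prop :=
  F.Finite ∧ ∀ ε : ℝ, 0 < ε → ∃ C : ℝ, ∀ n : ℕ, ((F ^ n).ncard : ℝ) ≤ C * Real.exp (ε * n)

/-- A self-similar iterated function system on `ℝ^k`: similarities
`x ↦ rᵢ Oᵢ x + tᵢ`, `i = 1, …, N`, with `N > 1`, `0 < rᵢ < 1` and `Oᵢ` orthogonal,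
that have no common fixed point. -/
structure SelfSimilarIFS (k N : ℕ) where
  one_lt : 1 < N
  ratio : Fin N → ℝ
  rot : Fin N → (EuclideanSpace ℝ (Fin k) ≃ₗᵢ[ℝ] EuclideanSpace ℝ (Fin k))
  trans : Fin N → EuclideanSpace ℝ (Fin k)
  ratio_pos : ∀ i, 0 < ratio i
  ratio_lt_one : ∀ i, ratio i < 1
  no_common_fixed : ¬ ∃ x, ∀ i, ratio i • rot i x + trans i = x

namespace SelfSimilarIFS

variable {k N : ℕ}

/-- The `i`-th similarity of the system. -/
noncomputable def map (Λ : SelfSimilarIFS k N) (i : Fin N) (x : EuclideanSpace ℝ (Fin k)) :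
    EuclideanSpace ℝ (Fin k) :=
  Λ.ratio i • Λ.rot i x + Λ.trans i

/-- The system is non-expanding if its set of orthogonal parts is. -/
def IsNonExpanding (Λ : SelfSimilarIFS k N) : Prop :=
  NonExpanding (Set.range Λ.rot)

/-- `K` is the attractor of the system: the non-empty compact set with `K = ⋃ᵢ fᵢ(K)`. -/
def IsAttractor (Λ : SelfSimilarIFS k N) (K : Set (EuclideanSpace ℝ (Fin k))) : Prop :=
  K.Nonempty ∧ IsCompact K ∧ K = ⋃ i, Λ.map i '' K

/-- `μ` is the self-similar measure of the system with weights `p`: the Borel probability measure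
supported on the attractor with `μ = ∑ᵢ pᵢ fᵢ(μ)`. -/
def IsStationary (Λ : SelfSimilarIFS k N) (p : Fin N → ℝ)
    (μ : Measure (EuclideanSpace ℝ (Fin k))) : Prop :=
  IsProbabilityMeasure μ ∧ (∃ K, Λ.IsAttractor K ∧ μ Kᶜ = 0) ∧
    μ = ∑ i, ENNReal.ofReal (p i) • μ.map (Λ.map i)

end SelfSimilarIFS

/-- A non-expanding self-similar set: the attractor of some non-expanding self-similar system. -/
def IsNonExpandingSelfSimilarSet {k : ℕ} (E : Set (EuclideanSpace ℝ (Fin k))) : Prop :=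
  ∃ (N : ℕ) (Λ : SelfSimilarIFS k N), Λ.IsNonExpanding ∧ Λ.IsAttractor E

/-- A non-expanding self-similar measure: the self-similar measure of some non-expanding
self-similar system and some weights `pᵢ ∈ (0, 1)` with sum `1`. -/
def IsNonExpandingSelfSimilarMeasure {k : ℕ} (μ : Measure (EuclideanSpace ℝ (Fin k))) : Prop :=
  ∃ (N : ℕ) (Λ : SelfSimilarIFS k N) (p : Fin N → ℝ), Λ.IsNonExpanding ∧
    (∀ i, 0 < p i ∧ p i < 1) ∧ ∑ i, p i = 1 ∧ Λ.IsStationary p μ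

/-- Ahlfors--David regularity: `μ(B_r(x)) ≍ r^s` uniformly over `x ∈ supp μ` and `0 < r ≤ 1`
(radii are bounded, since `μ` is finite). -/
def IsADRegular {k : ℕ} (μ : Measure (EuclideanSpace ℝ (Fin k))) : Prop :=
  ∃ s C : ℝ, 0 ≤ s ∧ 1 ≤ C ∧ ∀ x ∈ μ.support, ∀ r : ℝ, 0 < r → r ≤ 1 →
    C⁻¹ * r ^ s ≤ μ.real (Metric.ball x r) ∧ μ.real (Metric.ball x r) ≤ C * r ^ s

/-- The Fourier transform `ξ ↦ ∫ exp (-2πi⟨ξ, x⟩) dμ(x)` of a finite measure. -/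
noncomputable def fourierMeasure {k : ℕ} (μ : Measure (EuclideanSpace ℝ (Fin k)))
    (ξ : EuclideanSpace ℝ (Fin k)) : ℂ :=
  ∫ x, Complex.exp (((-2 * Real.pi * inner ℝ ξ x : ℝ) : ℂ) * Complex.I) ∂μ

/-- The Fourier `l²`-dimension `κ₂(μ)` (lower correlation dimension) of a Borel probability
measure: the supremum of `0 ≤ s < k` such that `∫_{B(0,R)} |μ̂|² = O(R^(k-s))`. -/
noncomputable def kappaTwo {k : ℕ} (μ : Measure (EuclideanSpace ℝ (Fin k))) : ℝ :=
  sSup {s : ℝ | 0 ≤ s ∧ s < k ∧ ∃ C : ℝ, ∀ R : ℝ, 0 < R →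
    ∫ ξ in Metric.ball (0 : EuclideanSpace ℝ (Fin k)) R, ‖fourierMeasure μ ξ‖ ^ 2
      ≤ C * R ^ ((k : ℝ) - s)}

/-- The Hessian matrix `(∂ᵢ∂ⱼ f (x))` of `f`. -/
noncomputable def hessianMatrix {k : ℕ} (f : EuclideanSpace ℝ (Fin k) → ℝ)
    (x : EuclideanSpace ℝ (Fin k)) : Matrix (Fin k) (Fin k) ℝ :=
  Matrix.of fun i j =>
    iteratedFDeriv ℝ 2 f x ![EuclideanSpace.single i 1, EuclideanSpace.single j 1]

/-- The measure `ν` on the line has a density in `L²` with respect to Lebesgue measure. -/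
def HasL2Density (ν : Measure ℝ) : Prop :=
  ∃ g : ℝ → ℝ, (∀ t, 0 ≤ g t) ∧ MemLp g 2 volume ∧
    ν = volume.withDensity fun t => ENNReal.ofReal (g t)

/-! It suffices to show `‖charFun (μ.map f) ξ‖ ^ 2 = O(ξ ^ (-γ))` for some `γ > 1`, since a
probability measure on the line with square-integrable transform has an `L²` density
(`hasL2Density_of_integrable_charFun`).

Cut `μ` into cylinders of ratio about `r = ξ ^ (-(3/4 + t))`, with `t > 0` small. On each of them
`f` is affine up to `O(r²)`, and the phase error `ξ r² = ξ ^ (-1/2 - 2t)` has square `ξ ^ (-1 -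
4t)`. The linearized integral has the modulus of `μ̂` at `R • O⁻¹ ∇f(x)`, where `O` is the rotation
of the cylinder, `x` any of its points coming from the attractor, and `R` is of order at least `ξ ^
(1/4 - t)`. Convexity of the square and averaging over `x` leave one integral `∫ |μ̂(R • O⁻¹
∇f(x))|² dμ(x)` for each linear part `(ratio, O)`; non-expansion makes the number of linear parts an
arbitrarily small power of `ξ` (`enorm_charFun_map_sq_le`).

Curvature enters in that integral (`exists_lintegral_gradient_decay`). The Hessian being invertible,
`∇f` is locally injective with Lipschitz inverse, so the image of `μ` under `∇f` keeps the bound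
`O(ρ ^ d)` on balls that AD-regularity gives. As `μ` has bounded support, `|μ̂|²` is controlled by
its unit-scale averages, so the integral is `O(R ^ (-d))` times the energy of `μ̂` at scale `R`. The
total is `R ^ (k - s - d) ≤ R ^ (k - 2s)`, because an energy exponent `s` never exceeds `d`. For `s
> 2 + k/2` the exponent is below `-4`, and `R ^ (-4)` is about `ξ ^ (-1)`: hence the threshold.

For sets, any `t < dimH E` admits finitely many disjoint cylinders with `∑ ratio ^ t > 1`
(`exists_disjoint_words`). They generate a separated non-expanding subsystem whose natural measure
is AD-regular, is carried by `E` and has large `κ₂`; its image under `f` is absolutely continuous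
and gives full mass to `f '' E`. -/

open Filter Topology

/-! ### Dyadic integration of decaying profiles. -/

/-- Integrating a decaying profile against a measure with polynomially growing balls. -/
theorem lintegral_inv_one_add_dist_pow_le {X : Type*} [PseudoMetricSpace X] [MeasurableSpace X]
    [OpensMeasurableSpace X] (lam : Measure X) {A : ℝ≥0∞} {α : ℝ} {m : ℕ}
    (hm : α + 1 ≤ m) (c : X) (h : ∀ ρ : ℝ, 0 < ρ → lam (Metric.ball c ρ) ≤ A * .ofReal (ρ ^ α))
    {ρ : ℝ} (hρ : 0 < ρ) :
    ∫⁻ z, .ofReal (((1 + dist z c / ρ) ^ m)⁻¹) ∂lam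
      ≤ .ofReal (2 ^ (α + 1)) * (A * .ofReal (ρ ^ α)) := by
  -- Dyadic shells: `j` is chosen with `2 ^ j ≤ 1 + d < 2 ^ (j + 1)`.
  have hpt : ∀ z, ENNReal.ofReal (((1 + dist z c / ρ) ^ m)⁻¹) ≤
      ∑' j : ℕ, (Metric.ball c (2 ^ (j + 1) * ρ)).indicator
        (fun _ => ENNReal.ofReal (((2 ^ j) ^ m)⁻¹)) z := by
    intro z
    set d := dist z c / ρ with hd
    have hd0 : 0 ≤ d := by positivity
    obtain ⟨j, hj1, hj2⟩ := exists_nat_pow_near (x := 1 + d) (y := (2 : ℝ)) (by linarith) (by norm_num)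
    refine le_trans ?_ (ENNReal.le_tsum j)
    rw [Set.indicator_of_mem]
    · apply ENNReal.ofReal_le_ofReal
      gcongr
    · rw [Metric.mem_ball, ← div_lt_iff₀ hρ]
      linarith
  calc ∫⁻ z, .ofReal (((1 + dist z c / ρ) ^ m)⁻¹) ∂lam
      ≤ ∫⁻ z, ∑' j : ℕ, (Metric.ball c (2 ^ (j + 1) * ρ)).indicator
        (fun _ => ENNReal.ofReal (((2 ^ j) ^ m)⁻¹)) z ∂lam := lintegral_mono hpt
    _ = ∑' j : ℕ, ENNReal.ofReal (((2 ^ j) ^ m)⁻¹) * lam (Metric.ball c (2 ^ (j + 1) * ρ)) := by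
        rw [lintegral_tsum]
        · congr! 2 with j
          rw [lintegral_indicator_const measurableSet_ball]
        · intro j
          exact (measurable_const.indicator measurableSet_ball).aemeasurable
    _ ≤ ∑' j : ℕ, ENNReal.ofReal (2 ^ α) * (A * .ofReal (ρ ^ α)) * (2⁻¹ : ℝ≥0∞) ^ j := by
        refine ENNReal.tsum_le_tsum fun j => ?_
        calc ENNReal.ofReal (((2 ^ j) ^ m)⁻¹) * lam (Metric.ball c (2 ^ (j + 1) * ρ))
            ≤ ENNReal.ofReal (((2 ^ j) ^ m)⁻¹) * (A * .ofReal ((2 ^ (j + 1) * ρ) ^ α)) := by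
              gcongr
              exact h _ (by positivity)
          _ = A * ENNReal.ofReal (((2 ^ j) ^ m)⁻¹ * (2 ^ (j + 1) * ρ) ^ α) := by
              rw [ENNReal.ofReal_mul (by positivity)]; ring
          _ ≤ A * ENNReal.ofReal (2 ^ α * ρ ^ α * (2⁻¹) ^ j) := by
              refine mul_le_mul_right (ENNReal.ofReal_le_ofReal ?_) A
              rw [Real.mul_rpow (by positivity) hρ.le, pow_succ, Real.mul_rpow (by positivity)
                (by positivity)]
              -- The margin `α + 1 ≤ m` leaves a spare factor `2⁻¹ ^ j`, which sums geometrically.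
              have h1 : ((2 : ℝ) ^ j) ^ α * 2 ^ j ≤ (2 ^ j) ^ m := by
                have : ((2 : ℝ) ^ j) ^ α * 2 ^ j = (2 ^ j) ^ (α + 1) := by
                  rw [Real.rpow_add (by positivity), Real.rpow_one]
                rw [this, ← Real.rpow_natCast (2 ^ j) m]
                exact Real.rpow_le_rpow_of_exponent_le (one_le_pow₀ (by norm_num)) hm
              have h2 : ((2 : ℝ) ^ j) ^ α ≤ (2 ^ j) ^ m * 2⁻¹ ^ j := by
                rw [inv_pow, ← div_eq_mul_inv, le_div_iff₀ (by positivity)]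
                exact h1
              rw [inv_mul_le_iff₀ (by positivity)]
              calc ((2 : ℝ) ^ j) ^ α * 2 ^ α * ρ ^ α
                  ≤ ((2 ^ j) ^ m * 2⁻¹ ^ j) * 2 ^ α * ρ ^ α := by gcongr
                _ = _ := by ring
          _ = _ := by
              rw [ENNReal.ofReal_mul (by positivity), ENNReal.ofReal_mul (by positivity),
                ENNReal.ofReal_pow (by positivity), ENNReal.ofReal_inv_of_pos (by norm_num)]
              norm_num
              ring
    _ = _ := by
        rw [ENNReal.tsum_mul_left, ENNReal.tsum_geometric, Real.rpow_add (by norm_num), Real.rpow_one,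
          ENNReal.ofReal_mul (by positivity)]
        norm_num
        ring

/-! ### Gaussian averages of characteristic functions. -/

section Gaussian

variable {V : Type*} [NormedAddCommGroup V] [InnerProductSpace ℝ V] [FiniteDimensional ℝ V]
  [MeasurableSpace V] [BorelSpace V]

omit [BorelSpace V] in
theorem norm_charFun_sq_eq (μ : Measure V) [IsFiniteMeasure μ] (ξ : V) :
    ((‖charFun μ ξ‖ ^ 2 : ℝ) : ℂ)
      = ∫ p : V × V, Complex.exp (Complex.I * (inner ℝ (p.1 - p.2) ξ : ℝ)) ∂(μ.prod μ) := by
  have h := integral_prod_mul (μ := μ) (ν := μ)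
    (fun x : V => Complex.exp ((inner ℝ x ξ : ℝ) * Complex.I))
    (fun x : V => Complex.exp ((inner ℝ x (-ξ) : ℝ) * Complex.I))
  rw [← charFun_apply, ← charFun_apply, charFun_neg, Complex.mul_conj'] at h
  push_cast
  rw [← h]
  congr 1
  ext p
  rw [← Complex.exp_add, inner_sub_left, inner_neg_right]
  push_cast
  ring_nf

theorem integrable_exp_neg_mul_sq_norm {b : ℝ} (hb : 0 < b) :
    Integrable (fun v : V => Real.exp (-b * ‖v‖ ^ 2)) := by
  have := (GaussianFourier.integrable_cexp_neg_mul_sq_norm_add (V := V) (b := b) (by simpa using hb)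
    0 0).norm
  refine this.congr (ae_of_all _ fun v => ?_)
  simp only [Complex.norm_exp]
  norm_cast
  simp

/-- Fubini and the transform of a Gaussian. This exchanges energy at frequencies up to `b ^ (-1/2)`
for correlation of `μ` at distance `b ^ (1/2)`, and replaces Plancherel in both directions below. -/
theorem integral_exp_mul_norm_charFun_sq (μ : Measure V) [IsFiniteMeasure μ] {b : ℝ} (hb : 0 < b) :
    ∫ ξ, Real.exp (-b * ‖ξ‖ ^ 2) * ‖charFun μ ξ‖ ^ 2
      = (Real.pi / b) ^ ((Module.finrank ℝ V : ℝ) / 2)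
        * ∫ p : V × V, Real.exp (-‖p.1 - p.2‖ ^ 2 / (4 * b)) ∂(μ.prod μ) := by
  have key : ∫ ξ : V, ((Real.exp (-b * ‖ξ‖ ^ 2) * ‖charFun μ ξ‖ ^ 2 : ℝ) : ℂ)
      = ∫ p : V × V, (((Real.pi / b) ^ ((Module.finrank ℝ V : ℝ) / 2)
        * Real.exp (-‖p.1 - p.2‖ ^ 2 / (4 * b)) : ℝ) : ℂ) ∂(μ.prod μ) := by
    have h1 : ∀ ξ : V, ((Real.exp (-b * ‖ξ‖ ^ 2) * ‖charFun μ ξ‖ ^ 2 : ℝ) : ℂ) =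
        ∫ p : V × V, Complex.exp (-b * ‖ξ‖ ^ 2 + Complex.I * (inner ℝ (p.1 - p.2) ξ : ℝ))
          ∂(μ.prod μ) := by
      intro ξ
      rw [Complex.ofReal_mul, norm_charFun_sq_eq, ← integral_const_mul]
      congr 1
      ext p
      rw [Complex.exp_add]
      push_cast
      rfl
    simp_rw [h1]
    rw [integral_integral_swap]
    · refine integral_congr_ae (ae_of_all _ fun p => ?_)
      have := GaussianFourier.integral_cexp_neg_mul_sq_norm_add (V := V) (b := b) (by simpa using hb)
        Complex.I (p.1 - p.2)
      simp only [this]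
      push_cast
      rw [Complex.ofReal_cpow (by positivity)]
      push_cast
      congr 2
      rw [Complex.I_sq]; ring
    · have hint : Integrable (fun z : V × (V × V) => Real.exp (-b * ‖z.1‖ ^ 2) * (1 : ℝ))
          (volume.prod (μ.prod μ)) :=
        (integrable_exp_neg_mul_sq_norm hb).mul_prod (integrable_const 1)
      refine hint.mono' ?_ (ae_of_all _ fun z => ?_)
      · apply Continuous.aestronglyMeasurable
        simp only [Function.uncurry_def]
        fun_prop
      · simp only [Function.uncurry, Complex.norm_exp, mul_one]
        apply le_of_eq
        congr 1
        simp only [Complex.add_re, Complex.mul_re, Complex.I_re, Complex.I_im, Complex.ofReal_re,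
          Complex.ofReal_im]
        rw [← Complex.ofReal_neg, ← Complex.ofReal_pow]
        simp only [Complex.ofReal_re, Complex.ofReal_im]
        ring
  rw [integral_complex_ofReal, integral_complex_ofReal] at key
  rw [Complex.ofReal_injective key, integral_const_mul]

omit [InnerProductSpace ℝ V] [FiniteDimensional ℝ V] in
theorem integrable_exp_neg_norm_sub_sq (μ : Measure V) [IsFiniteMeasure μ]
    [SecondCountableTopology V] {b : ℝ} (hb : 0 ≤ b) :
    Integrable (fun p : V × V => Real.exp (-‖p.1 - p.2‖ ^ 2 / b)) (μ.prod μ) := by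
  refine (integrable_const (1 : ℝ)).mono' (Continuous.aestronglyMeasurable (by fun_prop))
    (ae_of_all _ fun p => ?_)
  rw [Real.norm_of_nonneg (Real.exp_pos _).le, Real.exp_le_one_iff, neg_div]
  have : 0 ≤ ‖p.1 - p.2‖ ^ 2 / b := by positivity
  linarith

-- The indicator of `dist ≤ r` is at most `e` times a Gaussian of width `r`; the form `4 * (r ^ 2 /
-- 4)` matches the parameter `b = r ^ 2 / 4` of the Gaussian identity.
omit [InnerProductSpace ℝ V] [FiniteDimensional ℝ V] in
theorem lintegral_measure_closedBall_le (μ : Measure V) [IsFiniteMeasure μ]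
    [SecondCountableTopology V] {r : ℝ} (hr : 0 < r) :
    ∫⁻ x, μ (Metric.closedBall x r) ∂μ ≤ .ofReal (Real.exp 1 *
      ∫ p : V × V, Real.exp (-‖p.1 - p.2‖ ^ 2 / (4 * (r ^ 2 / 4))) ∂(μ.prod μ)) := by
  have hs : MeasurableSet {p : V × V | dist p.2 p.1 ≤ r} :=
    (isClosed_le (by fun_prop) continuous_const).measurableSet
  calc ∫⁻ x, μ (Metric.closedBall x r) ∂μ
      = (μ.prod μ) {p : V × V | dist p.2 p.1 ≤ r} := by
        rw [Measure.prod_apply hs]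
        rfl
    _ = ∫⁻ p, Set.indicator {p : V × V | dist p.2 p.1 ≤ r} 1 p ∂(μ.prod μ) := by
        rw [lintegral_indicator_one hs]
    _ ≤ ∫⁻ p : V × V, .ofReal (Real.exp 1 *
          Real.exp (-‖p.1 - p.2‖ ^ 2 / (4 * (r ^ 2 / 4)))) ∂(μ.prod μ) := by
        refine lintegral_mono (Set.indicator_le' (fun p hp => ?_) fun _ _ => zero_le)
        rw [Pi.one_apply, ENNReal.one_le_ofReal, ← Real.exp_add]
        apply Real.one_le_exp
        have hp' : ‖p.1 - p.2‖ ≤ r := by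
          rw [← dist_eq_norm, dist_comm]; exact hp
        have : ‖p.1 - p.2‖ ^ 2 / (4 * (r ^ 2 / 4)) ≤ 1 := by
          rw [div_le_one (by positivity)]
          nlinarith [norm_nonneg (p.1 - p.2)]
        rw [neg_div]; linarith
    _ = _ := by
        rw [← ofReal_integral_eq_lintegral_ofReal
          ((integrable_exp_neg_norm_sub_sq μ (by positivity)).const_mul _)
          (ae_of_all _ fun _ => by positivity), integral_const_mul]

end Gaussian

/-! ### Square-integrable transform implies an `L²` density. -/

/-- A probability measure on the line with square-integrable characteristic function has an `L²`
density. -/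
theorem hasL2Density_of_integrable_charFun (ν : Measure ℝ) [IsProbabilityMeasure ν]
    (h : Integrable (fun ξ => ‖charFun ν ξ‖ ^ 2)) : HasL2Density ν := by
  set M := ∫ ξ, ‖charFun ν ξ‖ ^ 2 with hM
  have hM0 : 0 ≤ M := integral_nonneg fun _ => by positivity
  have hball : ∀ r : ℝ, 0 < r →
      ∫⁻ x, ν (Metric.closedBall x r) ∂ν ≤ .ofReal (Real.exp 1 * M * r) := by
    intro r hr
    have hb : 0 < r ^ 2 / 4 := by positivity
    have hid := integral_exp_mul_norm_charFun_sq ν hb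
    have hle : ∫ ξ, Real.exp (-(r ^ 2 / 4) * ‖ξ‖ ^ 2) * ‖charFun ν ξ‖ ^ 2 ≤ M := by
      refine integral_mono_of_nonneg (ae_of_all _ fun _ => by positivity) h
        (ae_of_all _ fun ξ => ?_)
      refine mul_le_of_le_one_left (by positivity) ?_
      rw [Real.exp_le_one_iff, neg_mul]
      simp only [Left.neg_nonpos_iff]
      positivity
    set I := ∫ p : ℝ × ℝ, Real.exp (-‖p.1 - p.2‖ ^ 2 / (4 * (r ^ 2 / 4))) ∂(ν.prod ν) with hI
    have hIM : I ≤ M * r := by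
      have h2 : 1 / r ≤ (Real.pi / (r ^ 2 / 4)) ^ ((Module.finrank ℝ ℝ : ℝ) / 2) := by
        rw [Module.finrank_self, Nat.cast_one, ← Real.sqrt_eq_rpow]
        apply Real.le_sqrt_of_sq_le
        rw [div_pow, div_le_div_iff₀ (by positivity) (by positivity)]
        nlinarith [Real.pi_gt_three, sq_nonneg r]
      have hI0 : 0 ≤ I := integral_nonneg fun _ => (Real.exp_pos _).le
      have : 1 / r * I ≤ M := (mul_le_mul_of_nonneg_right h2 hI0).trans (hid ▸ hle)
      rw [one_div, inv_mul_le_iff₀ hr] at this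
      linarith
    refine (lintegral_measure_closedBall_le ν hr).trans (ENNReal.ofReal_le_ofReal ?_)
    rw [mul_assoc]
    gcongr
  set u : ℕ → ℝ := fun n => 1 / ((n : ℝ) + 1) with hu
  have hupos : ∀ n, 0 < u n := fun n => by positivity
  have hu0 : Tendsto u atTop (𝓝[>] 0) :=
    tendsto_nhdsWithin_iff.2 ⟨tendsto_one_div_add_atTop_nhds_zero_nat, .of_forall hupos⟩
  -- Lebesgue measure is differentiated with respect to `ν`, not conversely: the limit then exists
  -- `ν`-almost everywhere before absolute continuity is known.
  have hlim : ∀ᵐ x ∂ν, Tendsto (fun n => ν (Metric.closedBall x (u n)) / .ofReal (2 * u n)) atTop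
      (𝓝 ((volume.rnDeriv ν x)⁻¹)) := by
    filter_upwards [VitaliFamily.ae_tendsto_rnDeriv (Besicovitch.vitaliFamily ν) volume] with x hx
    have := (hx.comp ((Besicovitch.tendsto_filterAt ν x).comp hu0)).inv
    refine this.congr fun n => ?_
    simp only [Function.comp_apply, Real.volume_closedBall]
    rw [ENNReal.inv_div (Or.inr ENNReal.ofReal_ne_top)
      (Or.inr (by simpa using hupos n))]
  have hmeas : ∀ r : ℝ, Measurable fun x : ℝ => ν (Metric.closedBall x r) := by
    intro r
    have hs : MeasurableSet {p : ℝ × ℝ | dist p.2 p.1 ≤ r} :=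
      (isClosed_le (by fun_prop) continuous_const).measurableSet
    exact measurable_measure_prodMk_left hs
  -- Fatou's lemma: the averages over balls have integrals bounded uniformly in the radius by
  -- `hball`.
  have hfin : ∫⁻ x, (volume.rnDeriv ν x)⁻¹ ∂ν ≤ .ofReal (Real.exp 1 * M / 2) := by
    calc ∫⁻ x, (volume.rnDeriv ν x)⁻¹ ∂ν
        = ∫⁻ x, liminf (fun n => ν (Metric.closedBall x (u n)) / .ofReal (2 * u n)) atTop ∂ν := by
          refine lintegral_congr_ae ?_
          filter_upwards [hlim] with x hx using hx.liminf_eq.symm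
      _ ≤ liminf (fun n => ∫⁻ x, ν (Metric.closedBall x (u n)) / .ofReal (2 * u n) ∂ν) atTop :=
          lintegral_liminf_le fun n => (hmeas _).div_const _
      _ ≤ liminf (fun _ : ℕ => ENNReal.ofReal (Real.exp 1 * M / 2)) atTop := by
          refine liminf_le_liminf (.of_forall fun n => ?_)
          simp_rw [div_eq_mul_inv]
          rw [lintegral_mul_const _ (hmeas _), ← div_eq_mul_inv]
          refine ENNReal.div_le_of_le_mul ?_
          refine (hball _ (hupos n)).trans ?_
          rw [← ENNReal.ofReal_mul (by positivity)]
          apply ENNReal.ofReal_le_ofReal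
          apply le_of_eq
          ring
      _ = _ := by simp
  have hne : ∀ᵐ x ∂ν, volume.rnDeriv ν x ≠ 0 := by
    filter_upwards [ae_lt_top (Measure.measurable_rnDeriv volume ν).inv
      (ne_top_of_le_ne_top ENNReal.ofReal_ne_top hfin)] with x hx h0
    simp [h0] at hx
  -- On a Lebesgue-null set the derivative of `volume` integrates to zero against `ν`, yet it is
  -- non-zero `ν`-almost everywhere.
  have hac : ν ≪ volume := by
    refine Measure.AbsolutelyContinuous.mk fun s hs h0 => ?_
    have h1 : ∫⁻ x in s, volume.rnDeriv ν x ∂ν = 0 :=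
      le_antisymm ((Measure.setLIntegral_rnDeriv_le s).trans h0.le) zero_le
    rw [lintegral_eq_zero_iff (Measure.measurable_rnDeriv volume ν)] at h1
    rw [← Measure.restrict_eq_zero, ← ae_eq_bot]
    rw [← Filter.eventually_false_iff_eq_bot]
    filter_upwards [h1, ae_restrict_of_ae hne] with x hx hx2 using hx2 hx
  have hinv := Measure.inv_rnDeriv hac
  set g := ν.rnDeriv volume with hg
  have hgm : Measurable g := Measure.measurable_rnDeriv _ _
  have hgtop : ∀ᵐ x, g x < ⊤ := Measure.rnDeriv_lt_top ν volume
  have hwd : volume.withDensity g = ν := Measure.withDensity_rnDeriv_eq ν volume hac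
  refine ⟨fun t => (g t).toReal, fun t => ENNReal.toReal_nonneg, ?_, ?_⟩
  · refine ⟨hgm.ennreal_toReal.aestronglyMeasurable, ?_⟩
    rw [eLpNorm_lt_top_iff_lintegral_rpow_enorm_lt_top (by norm_num) (by norm_num)]
    -- `∫ g² = ∫ g dν`, and `g` is the inverse of the derivative bounded in `hfin`.
    have : ∫⁻ x, g x * g x ≤ .ofReal (Real.exp 1 * M / 2) := by
      calc ∫⁻ x, g x * g x = ∫⁻ x, g x ∂(volume.withDensity g) := by
            rw [lintegral_withDensity_eq_lintegral_mul _ hgm hgm]; rfl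
        _ = ∫⁻ x, (volume.rnDeriv ν x)⁻¹ ∂ν := by
            rw [hwd]
            refine lintegral_congr_ae ?_
            filter_upwards [hinv] with x hx
            rw [← hx]; simp
        _ ≤ _ := hfin
    refine lt_of_le_of_lt (lintegral_mono_ae ?_) (this.trans_lt ENNReal.ofReal_lt_top)
    filter_upwards [hgtop] with x hx
    rw [Real.enorm_eq_ofReal ENNReal.toReal_nonneg, ENNReal.ofReal_toReal hx.ne]
    norm_num
    rw [sq]
  · refine hwd.symm.trans ?_
    refine withDensity_congr_ae ?_
    filter_upwards [hgtop] with x hx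
    rw [ENNReal.ofReal_toReal hx.ne]

/-- From `1 + t ≤ exp t`, then completing the square in `m t - t²`. It lets Gaussians be fed to the
dyadic integration lemma. -/
theorem exp_neg_sq_le_inv_one_add_pow (m : ℕ) {t : ℝ} (ht : 0 ≤ t) :
    Real.exp (-t ^ 2) ≤ Real.exp ((m : ℝ) ^ 2 / 4) * ((1 + t) ^ m)⁻¹ := by
  rw [← div_eq_mul_inv, le_div_iff₀ (by positivity)]
  calc Real.exp (-t ^ 2) * (1 + t) ^ m ≤ Real.exp (-t ^ 2) * (Real.exp t) ^ m := by
        gcongr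
        linarith [Real.add_one_le_exp t]
    _ = Real.exp (-t ^ 2 + m * t) := by rw [Real.exp_add, ← Real.exp_nat_mul]
    _ ≤ _ := by
        rw [Real.exp_le_exp]
        nlinarith [sq_nonneg (t - m / 2)]

/-- Cauchy–Schwarz for the measure with density `a`, after splitting `a` into two square roots. -/
theorem sq_lintegral_mul_le {X : Type*} [MeasurableSpace X] (lam : Measure X) {a b : X → ℝ≥0∞}
    (ha : AEMeasurable a lam) (hb : AEMeasurable b lam) :
    (∫⁻ x, a x * b x ∂lam) ^ 2 ≤ (∫⁻ x, a x ∂lam) * ∫⁻ x, a x * b x ^ 2 ∂lam := by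
  have h := ENNReal.lintegral_mul_le_Lp_mul_Lq lam Real.HolderConjugate.two_two
    (f := fun x => a x ^ (1 / 2 : ℝ)) (g := fun x => a x ^ (1 / 2 : ℝ) * b x)
    (ha.pow_const _) ((ha.pow_const _).mul hb)
  have hsq : ∀ y : ℝ≥0∞, (y ^ (1 / 2 : ℝ)) ^ 2 = y := fun y => by
    rw [← ENNReal.rpow_natCast, ← ENNReal.rpow_mul]; norm_num
  have e1 : ∫⁻ x, ((fun x => a x ^ (1 / 2 : ℝ)) * fun x => a x ^ (1 / 2 : ℝ) * b x) x ∂lam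
      = ∫⁻ x, a x * b x ∂lam := by
    congr 1; ext x
    simp only [Pi.mul_apply]
    rw [← mul_assoc, ← sq, hsq]
  have e2 : ∀ x, (a x ^ (1 / 2 : ℝ)) ^ (2 : ℝ) = a x := fun x => by
    rw [← ENNReal.rpow_mul]; norm_num
  have e3 : ∀ x, (a x ^ (1 / 2 : ℝ) * b x) ^ (2 : ℝ) = a x * b x ^ 2 := fun x => by
    rw [ENNReal.mul_rpow_of_nonneg _ _ (by norm_num), e2, ENNReal.rpow_two]
  rw [e1] at h
  simp only [e2, e3] at h
  calc _ ≤ ((∫⁻ x, a x ∂lam) ^ (1 / 2 : ℝ) * (∫⁻ x, a x * b x ^ 2 ∂lam) ^ (1 / 2 : ℝ)) ^ 2 := by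
        gcongr
    _ = _ := by rw [mul_pow, hsq, hsq]

/-! ### Local control of `μ̂` and its averages over rescaled measures. -/

section FourierMeasure

variable {k : ℕ}

local notation "𝔼" => EuclideanSpace ℝ (Fin k)

theorem fourierMeasure_eq_charFun (μ : Measure 𝔼) (ξ : 𝔼) :
    fourierMeasure μ ξ = charFun μ ((-(2 * Real.pi)) • ξ) := by
  rw [fourierMeasure, charFun_apply]
  congr 1; ext x
  rw [inner_smul_right, real_inner_comm ξ x]
  congr 3
  ring

theorem continuous_fourierMeasure (μ : Measure 𝔼) [IsFiniteMeasure μ] :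
    Continuous (fourierMeasure μ) := by
  have : fourierMeasure μ = fun ξ => charFun μ ((-(2 * Real.pi)) • ξ) :=
    funext fun ξ => fourierMeasure_eq_charFun μ ξ
  rw [this]
  exact continuous_charFun.comp (by fun_prop)

theorem norm_fourierMeasure_le_one (μ : Measure 𝔼) [IsProbabilityMeasure μ] (ξ : 𝔼) :
    ‖fourierMeasure μ ξ‖ ≤ 1 := by
  rw [fourierMeasure_eq_charFun]
  exact norm_charFun_le_one _

/-- The Gaussian identity in the `2π` normalization; the Jacobian of the dilation cancels the change
in the prefactor. -/
theorem integral_exp_mul_norm_fourierMeasure_sq (μ : Measure 𝔼) [IsFiniteMeasure μ] {b : ℝ}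
    (hb : 0 < b) :
    ∫ ξ, Real.exp (-b * ‖ξ‖ ^ 2) * ‖fourierMeasure μ ξ‖ ^ 2
      = (Real.pi / b) ^ ((k : ℝ) / 2)
        * ∫ p : 𝔼 × 𝔼, Real.exp (-(Real.pi ^ 2 / b * ‖p.1 - p.2‖ ^ 2)) ∂(μ.prod μ) := by
  have hpi := Real.pi_pos
  have h1 := integral_exp_mul_norm_charFun_sq μ (b := b / (4 * Real.pi ^ 2)) (by positivity)
  have h2 := Measure.integral_comp_smul (volume : Measure 𝔼)
    (fun ξ => Real.exp (-(b / (4 * Real.pi ^ 2)) * ‖ξ‖ ^ 2) * ‖charFun μ ξ‖ ^ 2)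
    (-(2 * Real.pi))
  rw [h1] at h2
  have h3 : ∀ ξ : 𝔼, -(b / (4 * Real.pi ^ 2)) * ‖(-(2 * Real.pi)) • ξ‖ ^ 2 = -b * ‖ξ‖ ^ 2 := by
    intro ξ
    rw [norm_smul, norm_neg, Real.norm_of_nonneg (by positivity)]
    field_simp
    ring
  simp only [h3, ← fourierMeasure_eq_charFun, finrank_euclideanSpace_fin] at h2
  rw [h2, smul_eq_mul, ← mul_assoc]
  congr 1
  · rw [abs_inv, abs_pow, abs_neg, abs_of_pos (by positivity : 0 < 2 * Real.pi),
      ← Real.rpow_natCast, ← Real.rpow_neg (by positivity)]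
    generalize h2pi : 2 * Real.pi = τ
    have hτ : 0 < τ := h2pi ▸ by positivity
    have : Real.pi / (b / (4 * Real.pi ^ 2)) = τ ^ (2 : ℝ) * (Real.pi / b) := by
      rw [Real.rpow_two, ← h2pi]
      field_simp
      ring
    rw [this, Real.mul_rpow (by positivity) (by positivity), ← Real.rpow_mul (by positivity),
      ← mul_assoc, ← Real.rpow_add (by positivity)]
    rw [show -(k : ℝ) + 2 * (k / 2) = 0 by ring, Real.rpow_zero, one_mul]
  · congr 1; ext p
    congr 1
    field_simp

open FourierTransform in
/-- The Fourier transform of a compactly supported measure is controlled by its local averages. -/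
theorem enorm_fourierMeasure_sq_le (μ : Measure 𝔼) [IsFiniteMeasure μ] {L : ℝ}
    (hL : ∀ᵐ x ∂μ, ‖x‖ ≤ L) (M : ℕ) : ∃ C : ℝ, ∀ η, ‖fourierMeasure μ η‖ₑ ^ 2 ≤
      .ofReal C * ∫⁻ ζ, .ofReal (((1 + dist ζ η) ^ M)⁻¹) * ‖fourierMeasure μ ζ‖ₑ ^ 2 := by
  -- The bump is `1` on the ball carrying `μ`, so multiplying `μ` by it changes nothing; on the
  -- Fourier side this reads `μ̂ = ψ * μ̂` with `ψ` Schwartz (`hconv`).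
  let bump : ContDiffBump (0 : 𝔼) := ⟨max L 1, max L 1 + 1, by positivity, by linarith⟩
  have hbc : ContDiff ℝ ∞ (fun x => (bump x : ℂ)) := Complex.ofRealCLM.contDiff.comp bump.contDiff
  have hbs : HasCompactSupport (fun x => (bump x : ℂ)) :=
    bump.hasCompactSupport.comp_left Complex.ofReal_zero
  let φ : SchwartzMap 𝔼 ℂ := hbs.toSchwartzMap hbc
  let ψ : SchwartzMap 𝔼 ℂ := 𝓕 φ
  have hφ : ∀ x : 𝔼, ‖x‖ ≤ L →
      ∫ v, Complex.exp ((2 * Real.pi * inner ℝ v x : ℝ) * Complex.I) * ψ v = 1 := by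
    intro x hx
    have h1 : 𝓕⁻ (𝓕 (φ : 𝔼 → ℂ)) = φ :=
      φ.continuous.fourierInv_fourier_eq φ.integrable (by
        rw [← SchwartzMap.fourier_coe]; exact (𝓕 φ).integrable)
    have h2 := congrFun h1 x
    rw [Real.fourierInv_eq', ← SchwartzMap.fourier_coe] at h2
    simp only [smul_eq_mul] at h2
    rw [h2]
    have : bump x = 1 := bump.one_of_mem_closedBall (by
      rw [mem_closedBall_zero_iff]; exact hx.trans (le_max_left _ _))
    change ((bump x : ℝ) : ℂ) = 1
    rw [this]; simp
  have hconv : ∀ η, fourierMeasure μ η = ∫ v, ψ v * fourierMeasure μ (η - v) := by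
    intro η
    calc fourierMeasure μ η
        = ∫ x, ∫ v, Complex.exp ((-2 * Real.pi * inner ℝ η x : ℝ) * Complex.I) *
            (Complex.exp ((2 * Real.pi * inner ℝ v x : ℝ) * Complex.I) * ψ v) ∂volume ∂μ := by
          rw [fourierMeasure]
          refine integral_congr_ae ?_
          filter_upwards [hL] with x hx
          rw [integral_const_mul, hφ x hx, mul_one]
      _ = ∫ v, ∫ x, Complex.exp ((-2 * Real.pi * inner ℝ η x : ℝ) * Complex.I) *
            (Complex.exp ((2 * Real.pi * inner ℝ v x : ℝ) * Complex.I) * ψ v) ∂μ ∂volume := by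
          refine integral_integral_swap ?_
          have hint : Integrable (fun z : 𝔼 × 𝔼 => (1 : ℝ) * ‖ψ z.2‖) (μ.prod volume) :=
            (integrable_const 1).mul_prod ψ.integrable.norm
          refine hint.mono' ?_ (ae_of_all _ fun z => ?_)
          · have := ψ.continuous
            apply Continuous.aestronglyMeasurable
            simp only [Function.uncurry_def]
            fun_prop
          · simp only [Function.uncurry, norm_mul, Complex.norm_exp_ofReal_mul_I, one_mul, le_refl]
      _ = _ := by
          congr 1; ext v
          rw [fourierMeasure, ← integral_const_mul]
          congr 1; ext x
          rw [← mul_assoc, ← Complex.exp_add, mul_comm, inner_sub_left]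
          congr 2
          push_cast
          ring
  obtain ⟨C₁, hC₁⟩ : ∃ C : ℝ, ∀ v, ‖ψ v‖ ≤ C * ((1 + ‖v‖) ^ M)⁻¹ := by
    refine ⟨2 ^ M * ((Finset.Iic (M, 0)).sup fun m => SchwartzMap.seminorm ℂ m.1 m.2) ψ,
      fun v => ?_⟩
    have := SchwartzMap.one_add_le_sup_seminorm_apply (𝕜 := ℂ) (m := (M, 0)) (k := M) (n := 0)
      le_rfl le_rfl ψ v
    rw [norm_iteratedFDeriv_zero] at this
    rw [← div_eq_mul_inv, le_div_iff₀ (by positivity), mul_comm]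
    exact this
  have hFm : Measurable fun ζ => ‖fourierMeasure μ ζ‖ₑ :=
    (continuous_fourierMeasure μ).measurable.enorm
  have hfin : ∫⁻ v, ‖ψ v‖ₑ ≠ ⊤ := ψ.integrable.2.ne
  refine ⟨(∫⁻ v, ‖ψ v‖ₑ).toReal * C₁, fun η => ?_⟩
  calc ‖fourierMeasure μ η‖ₑ ^ 2
      ≤ (∫⁻ v, ‖ψ v‖ₑ * ‖fourierMeasure μ (η - v)‖ₑ) ^ 2 := by
        gcongr
        rw [hconv]
        refine (enorm_integral_le_lintegral_enorm _).trans (le_of_eq ?_)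
        simp only [enorm_mul]
    _ ≤ (∫⁻ v, ‖ψ v‖ₑ) * ∫⁻ v, ‖ψ v‖ₑ * ‖fourierMeasure μ (η - v)‖ₑ ^ 2 := by
        refine sq_lintegral_mul_le _ ψ.continuous.measurable.enorm.aemeasurable ?_
        exact (hFm.comp (measurable_const.sub measurable_id)).aemeasurable
    _ ≤ (∫⁻ v, ‖ψ v‖ₑ) * ∫⁻ v, .ofReal C₁ * (.ofReal (((1 + dist (η - v) η) ^ M)⁻¹) *
          ‖fourierMeasure μ (η - v)‖ₑ ^ 2) := by
        refine mul_le_mul_right (lintegral_mono fun v => ?_) _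
        rw [← mul_assoc]
        refine mul_le_mul_left ?_ _
        rw [← ENNReal.ofReal_mul' (by positivity), ← ofReal_norm]
        apply ENNReal.ofReal_le_ofReal
        have : dist (η - v) η = ‖v‖ := by rw [dist_eq_norm]; simp
        rw [this]
        exact hC₁ v
    _ = _ := by
        rw [lintegral_const_mul' _ _ ENNReal.ofReal_ne_top, ← mul_assoc,
          ENNReal.ofReal_mul ENNReal.toReal_nonneg, ENNReal.ofReal_toReal hfin]
        congr 1
        exact lintegral_sub_left_eq_self
          (fun ζ => ENNReal.ofReal (((1 + dist ζ η) ^ M)⁻¹) * ‖fourierMeasure μ ζ‖ₑ ^ 2) η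

/-- Pulled back by the similarity, the unit profile at `ζ` has width `R⁻¹` and centre `c`. The
exponent is split: `m₁` powers meet the ball bound and produce `R ^ (-s)`, while `m₂` powers keep
decay in `‖ζ‖ / R`, because `ν` lives in a bounded ball and a distant `c` is far from all its mass.
-/
theorem lintegral_profile_le (ν : Measure 𝔼) {L' : ℝ} (hL' : 0 ≤ L') (hνL : ∀ᵐ x ∂ν, ‖x‖ ≤ L')
    {s A : ℝ} (hν : ∀ c, ∀ ρ : ℝ, 0 < ρ → ν (Metric.ball c ρ) ≤ .ofReal A * .ofReal (ρ ^ s))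
    {m₁ : ℕ} (hm₁ : s + 1 ≤ m₁) (m₂ : ℕ) {R : ℝ} (hR : 1 ≤ R) (O : 𝔼 ≃ₗᵢ[ℝ] 𝔼) (ζ : 𝔼) :
    ∫⁻ z, .ofReal (((1 + dist ζ (R • O z)) ^ (m₁ + m₂))⁻¹) ∂ν
      ≤ .ofReal ((1 + L') ^ m₂ * (2 ^ (s + 1) * max A 0) * R ^ (-s)) *
        .ofReal (((1 + dist ζ 0 / R) ^ m₂)⁻¹) := by
  have hR0 : 0 < R := by linarith
  set c : 𝔼 := R⁻¹ • O.symm ζ with hc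
  have hdist : ∀ z, dist ζ (R • O z) = dist z c / R⁻¹ := by
    intro z
    have : ζ = R • O c := by
      rw [hc, map_smul, smul_smul, mul_inv_cancel₀ hR0.ne', one_smul,
        LinearIsometryEquiv.apply_symm_apply]
    rw [this, dist_smul₀, O.dist_map, Real.norm_of_nonneg hR0.le, dist_comm, div_inv_eq_mul,
      mul_comm]
  have hcn : dist ζ 0 / R = ‖c‖ := by
    rw [hc, norm_smul, norm_inv, Real.norm_of_nonneg hR0.le, LinearIsometryEquiv.norm_map,
      dist_zero_right, div_eq_inv_mul]
  calc ∫⁻ z, .ofReal (((1 + dist ζ (R • O z)) ^ (m₁ + m₂))⁻¹) ∂ν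
      ≤ ∫⁻ z, .ofReal ((1 + L') ^ m₂ * ((1 + dist ζ 0 / R) ^ m₂)⁻¹) *
          .ofReal (((1 + dist z c / R⁻¹) ^ m₁)⁻¹) ∂ν := by
        refine lintegral_mono_ae ?_
        filter_upwards [hνL] with z hz
        rw [← ENNReal.ofReal_mul (by positivity)]
        apply ENNReal.ofReal_le_ofReal
        rw [hdist, pow_add, mul_inv, mul_comm]
        refine mul_le_mul_of_nonneg_right ?_ (by positivity)
        rw [← inv_inv ((1 + L') ^ m₂), ← mul_inv]
        refine inv_anti₀ (by positivity) ?_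
        rw [inv_mul_le_iff₀ (by positivity), ← mul_pow, hcn]
        gcongr
        have h1 : ‖c‖ ≤ dist z c + L' := by
          have : ‖c‖ ≤ ‖z‖ + dist z c := by
            have := norm_sub_norm_le c z
            rw [dist_comm, dist_eq_norm]; linarith
          linarith
        have h2 : dist z c ≤ dist z c / R⁻¹ := by
          rw [div_inv_eq_mul]
          exact le_mul_of_one_le_right dist_nonneg hR
        have h3 : 0 ≤ dist z c := dist_nonneg
        nlinarith
    _ ≤ .ofReal ((1 + L') ^ m₂ * ((1 + dist ζ 0 / R) ^ m₂)⁻¹) *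
          (.ofReal (2 ^ (s + 1)) * (.ofReal A * .ofReal (R⁻¹ ^ s))) := by
        rw [lintegral_const_mul' _ _ ENNReal.ofReal_ne_top]
        gcongr
        exact lintegral_inv_one_add_dist_pow_le ν hm₁ c (hν c) (by positivity)
    _ = _ := by
        have hA : ENNReal.ofReal A = .ofReal (max A 0) := by
          rw [ENNReal.ofReal_max, ENNReal.ofReal_zero, max_eq_left zero_le]
        rw [hA, ← ENNReal.ofReal_mul (by positivity), ← ENNReal.ofReal_mul (by positivity),
          ← ENNReal.ofReal_mul (by positivity), ← ENNReal.ofReal_mul (by positivity)]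
        congr 1
        rw [Real.inv_rpow hR0.le, Real.rpow_neg hR0.le]
        ring

/-- Averages over `x ∈ ν` of `|μ̂|²` along rescaled and rotated copies of `ν`. -/
theorem lintegral_enorm_fourierMeasure_sq_le (μ ν : Measure 𝔼) [IsFiniteMeasure μ]
    [IsFiniteMeasure ν] {L : ℝ} (hμL : ∀ᵐ x ∂μ, ‖x‖ ≤ L) (hνL : ∀ᵐ x ∂ν, ‖x‖ ≤ L)
    {s β A B : ℝ}
    (hν : ∀ c, ∀ ρ : ℝ, 0 < ρ → ν (Metric.ball c ρ) ≤ .ofReal A * .ofReal (ρ ^ s))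
    (hμ : ∀ R : ℝ, 0 < R → ∫⁻ ξ in Metric.ball 0 R, ‖fourierMeasure μ ξ‖ₑ ^ 2
      ≤ .ofReal B * .ofReal (R ^ β)) :
    ∃ C : ℝ, ∀ R : ℝ, 1 ≤ R → ∀ O : 𝔼 ≃ₗᵢ[ℝ] 𝔼,
      ∫⁻ z, ‖fourierMeasure μ (R • O z)‖ₑ ^ 2 ∂ν ≤ .ofReal C * .ofReal (R ^ (β - s)) := by
  obtain ⟨m₁, hm₁⟩ := exists_nat_ge (s + 1)
  obtain ⟨m₂, hm₂⟩ := exists_nat_ge (β + 1)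
  obtain ⟨C₀, hC₀⟩ := enorm_fourierMeasure_sq_le μ hμL (m₁ + m₂)
  obtain ⟨L', hL', hLL'⟩ : ∃ L' : ℝ, 0 ≤ L' ∧ L ≤ L' := ⟨max L 0, le_max_right _ _, le_max_left _ _⟩
  have hFm : Measurable fun ζ => ‖fourierMeasure μ ζ‖ₑ ^ 2 :=
    (continuous_fourierMeasure μ).measurable.enorm.pow_const 2
  set lam : Measure 𝔼 := volume.withDensity fun ζ => ‖fourierMeasure μ ζ‖ₑ ^ 2 with hlam
  have hlamball : ∀ R : ℝ, 0 < R → lam (Metric.ball 0 R) ≤ .ofReal B * .ofReal (R ^ β) := by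
    intro R hR
    rw [hlam, withDensity_apply _ measurableSet_ball]
    exact hμ R hR
  use max C₀ 0 * ((1 + L') ^ m₂ * (2 ^ (s + 1) * max A 0) * (2 ^ (β + 1) * B))
  intro R hR O
  have hR0 : 0 < R := by linarith
  have hpt := lintegral_profile_le ν hL' (hνL.mono fun x hx => hx.trans hLL') hν hm₁
    m₂ hR O
  have hprofm : Measurable fun p : 𝔼 × 𝔼 =>
      ENNReal.ofReal (((1 + dist p.2 (R • O p.1)) ^ (m₁ + m₂))⁻¹) := by
    apply Measurable.ennreal_ofReal
    have : Measurable fun p : 𝔼 × 𝔼 => (1 + dist p.2 (R • O p.1)) ^ (m₁ + m₂) :=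
      Continuous.measurable (by fun_prop)
    exact this.inv
  have step1 : ∀ z : 𝔼, ‖fourierMeasure μ (R • O z)‖ₑ ^ 2 ≤ ENNReal.ofReal (max C₀ 0) *
        ∫⁻ ζ, .ofReal (((1 + dist ζ (R • O z)) ^ (m₁ + m₂))⁻¹) ∂lam := by
    intro z
    have hg : Measurable fun ζ : 𝔼 =>
        ENNReal.ofReal (((1 + dist ζ (R • O z)) ^ (m₁ + m₂))⁻¹) := by
      have : Measurable fun ζ : 𝔼 => (1 + dist ζ (R • O z)) ^ (m₁ + m₂) :=
        Continuous.measurable (by fun_prop)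
      exact this.inv.ennreal_ofReal
    have := lintegral_withDensity_eq_lintegral_mul volume hFm hg
    rw [hlam, this]
    refine (hC₀ (R • O z)).trans ?_
    refine mul_le_mul' (ENNReal.ofReal_le_ofReal (le_max_left _ _)) (le_of_eq ?_)
    refine lintegral_congr fun ζ => ?_
    rw [Pi.mul_apply, mul_comm]
  -- After the swap, the integral in `z` costs `R ^ (-s)` and leaves a profile of width `R`;
  -- integrating that against the energy measure `lam` gives `R ^ β`.
  have step2 : ∫⁻ z, ENNReal.ofReal (max C₀ 0) *
      ∫⁻ ζ, .ofReal (((1 + dist ζ (R • O z)) ^ (m₁ + m₂))⁻¹) ∂lam ∂ν = ENNReal.ofReal (max C₀ 0) *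
        ∫⁻ ζ, ∫⁻ z, .ofReal (((1 + dist ζ (R • O z)) ^ (m₁ + m₂))⁻¹) ∂ν ∂lam := by
    rw [lintegral_const_mul' _ _ ENNReal.ofReal_ne_top, lintegral_lintegral_swap]
    exact hprofm.aemeasurable
  have step3 : ∫⁻ ζ, ∫⁻ z, .ofReal (((1 + dist ζ (R • O z)) ^ (m₁ + m₂))⁻¹) ∂ν ∂lam
      ≤ ENNReal.ofReal ((1 + L') ^ m₂ * (2 ^ (s + 1) * max A 0) * R ^ (-s)) *
        (ENNReal.ofReal (2 ^ (β + 1)) * (.ofReal B * .ofReal (R ^ β))) := by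
    refine (lintegral_mono hpt).trans ?_
    rw [lintegral_const_mul' _ _ ENNReal.ofReal_ne_top]
    exact mul_le_mul_right (lintegral_inv_one_add_dist_pow_le lam hm₂ 0 hlamball hR0) _
  refine (lintegral_mono step1).trans (step2.le.trans ((mul_le_mul_right step3 _).trans
    (le_of_eq ?_)))
  have h1 : (0 : ℝ) ≤ R ^ β := by positivity
  rw [← ENNReal.ofReal_mul' h1, ← ENNReal.ofReal_mul (by positivity),
    ← ENNReal.ofReal_mul (by positivity), ← ENNReal.ofReal_mul (by positivity),
    ← ENNReal.ofReal_mul' (by positivity)]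
  congr 1
  rw [sub_eq_add_neg, Real.rpow_add hR0]
  ring

end FourierMeasure

/-! ### Energy exponents and mass of balls. -/

section Energy

variable {k : ℕ}

local notation "𝔼" => EuclideanSpace ℝ (Fin k)

theorem enorm_sq_eq_ofReal (z : ℂ) : ‖z‖ₑ ^ 2 = .ofReal (‖z‖ ^ 2) := by
  rw [ENNReal.ofReal_pow (norm_nonneg _), ofReal_norm]

theorem integrableOn_ball_norm_fourierMeasure_sq (μ : Measure 𝔼) [IsFiniteMeasure μ] (R : ℝ) :
    IntegrableOn (fun ξ => ‖fourierMeasure μ ξ‖ ^ 2) (Metric.ball 0 R) := by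
  have hc : Continuous fun ξ => ‖fourierMeasure μ ξ‖ ^ 2 :=
    (continuous_fourierMeasure μ).norm.pow 2
  exact (hc.continuousOn.integrableOn_compact (isCompact_closedBall 0 R)).mono_set
    Metric.ball_subset_closedBall

theorem bddAbove_kappaTwo_set (μ : Measure 𝔼) : BddAbove {s : ℝ | 0 ≤ s ∧ s < k ∧ ∃ C : ℝ,
    ∀ R : ℝ, 0 < R → ∫ ξ in Metric.ball (0 : 𝔼) R, ‖fourierMeasure μ ξ‖ ^ 2
      ≤ C * R ^ ((k : ℝ) - s)} :=
  ⟨k, fun _ hs => hs.2.1.le⟩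

theorem exists_exponent_of_lt_kappaTwo (μ : Measure 𝔼) [IsFiniteMeasure μ] {a : ℝ} (ha : 0 ≤ a)
    (h : a < kappaTwo μ) : ∃ s B : ℝ, a < s ∧ s < k ∧ 0 ≤ B ∧ ∀ R : ℝ, 0 < R →
      ∫⁻ ξ in Metric.ball 0 R, ‖fourierMeasure μ ξ‖ₑ ^ 2
        ≤ .ofReal B * .ofReal (R ^ ((k : ℝ) - s)) := by
  obtain ⟨s, ⟨hs0, hsk, C, hC⟩, has⟩ := exists_lt_of_lt_csSup (by
    -- The real `sSup ∅` is `0`, so `0 ≤ a < kappaTwo μ` excludes the empty set.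
    by_contra hne
    rw [Set.not_nonempty_iff_eq_empty] at hne
    rw [kappaTwo, hne, Real.sSup_empty] at h
    linarith) h
  refine ⟨s, max C 0, has, hsk, le_max_right _ _, fun R hR => ?_⟩
  simp only [enorm_sq_eq_ofReal]
  rw [← ofReal_integral_eq_lintegral_ofReal (integrableOn_ball_norm_fourierMeasure_sq μ R)
    (ae_of_all _ fun _ => by positivity), ← ENNReal.ofReal_mul (le_max_right _ _)]
  apply ENNReal.ofReal_le_ofReal
  refine (hC R hR).trans ?_
  gcongr
  exact le_max_left _ _

theorem integrable_exp_mul_norm_fourierMeasure_sq (μ : Measure 𝔼) [IsProbabilityMeasure μ] {b : ℝ}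
    (hb : 0 < b) : Integrable fun ξ => Real.exp (-b * ‖ξ‖ ^ 2) * ‖fourierMeasure μ ξ‖ ^ 2 := by
  refine (integrable_exp_neg_mul_sq_norm hb).mono' ?_ (ae_of_all _ fun ξ => ?_)
  · have := continuous_fourierMeasure μ
    exact Continuous.aestronglyMeasurable (by fun_prop)
  · rw [Real.norm_of_nonneg (by positivity)]
    refine mul_le_of_le_one_right (by positivity) ?_
    exact pow_le_one₀ (norm_nonneg _) (norm_fourierMeasure_le_one μ ξ)

/-- Fourier energy bounds control the mass of small balls on average. -/
theorem lintegral_measure_closedBall_le_rpow (μ : Measure 𝔼) [IsProbabilityMeasure μ] {β B : ℝ}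
    (hμ : ∀ R : ℝ, 0 < R → ∫⁻ ξ in Metric.ball 0 R, ‖fourierMeasure μ ξ‖ₑ ^ 2
      ≤ .ofReal B * .ofReal (R ^ β)) :
    ∃ C : ℝ, ∀ r : ℝ, 0 < r →
      ∫⁻ x, μ (Metric.closedBall x r) ∂μ ≤ .ofReal (C * r ^ ((k : ℝ) - β)) := by
  have hpi := Real.pi_pos
  obtain ⟨m, hm⟩ := exists_nat_ge (β + 1)
  have hFm : Measurable fun ζ => ‖fourierMeasure μ ζ‖ₑ ^ 2 :=
    (continuous_fourierMeasure μ).measurable.enorm.pow_const 2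
  have hball : ∀ R : ℝ, 0 < R → (volume.withDensity fun ζ => ‖fourierMeasure μ ζ‖ₑ ^ 2)
      (Metric.ball 0 R) ≤ .ofReal B * .ofReal (R ^ β) := by
    intro R hR
    rw [withDensity_apply _ measurableSet_ball]
    exact hμ R hR
  set D := Real.exp ((m : ℝ) ^ 2 / 4) * (2 ^ (β + 1) * max B 0) with hD
  refine ⟨Real.exp 1 * (Real.pi ^ ((k : ℝ) / 2) * D), fun r hr => ?_⟩
  refine (lintegral_measure_closedBall_le μ hr).trans (ENNReal.ofReal_le_ofReal ?_)
  -- This `b` makes the spatial Gaussian `exp (-‖x - y‖² / r²)`, the one that dominates the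
  -- indicator; the prefactor then equals `(π r²) ^ (-k/2)`.
  have hid := integral_exp_mul_norm_fourierMeasure_sq μ (b := (Real.pi * r) ^ 2) (by positivity)
  have hcongr : ∀ p : 𝔼 × 𝔼, -(Real.pi ^ 2 / (Real.pi * r) ^ 2 * ‖p.1 - p.2‖ ^ 2)
      = -‖p.1 - p.2‖ ^ 2 / (4 * (r ^ 2 / 4)) := by
    intro p; field_simp
  simp only [hcongr] at hid
  set I := ∫ p : 𝔼 × 𝔼, Real.exp (-‖p.1 - p.2‖ ^ 2 / (4 * (r ^ 2 / 4))) ∂(μ.prod μ) with hI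
  set J := ∫ ξ, Real.exp (-(Real.pi * r) ^ 2 * ‖ξ‖ ^ 2) * ‖fourierMeasure μ ξ‖ ^ 2 with hJ
  have hJle : J ≤ D * r ^ (-β) := by
    rw [← ENNReal.ofReal_le_ofReal_iff (by positivity), hJ,
      ofReal_integral_eq_lintegral_ofReal
        (integrable_exp_mul_norm_fourierMeasure_sq μ (by positivity))
        (ae_of_all _ fun _ => by positivity)]
    have hg : Measurable fun ζ : 𝔼 => ENNReal.ofReal (((1 + dist ζ 0 / r⁻¹) ^ m)⁻¹) := by
      have : Measurable fun ζ : 𝔼 => (1 + dist ζ 0 / r⁻¹) ^ m :=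
        Continuous.measurable (by fun_prop)
      exact this.inv.ennreal_ofReal
    have hle := lintegral_inv_one_add_dist_pow_le _ hm 0 hball (inv_pos.2 hr)
    rw [lintegral_withDensity_eq_lintegral_mul volume hFm hg] at hle
    simp only [Pi.mul_apply] at hle
    calc ∫⁻ ξ, .ofReal (Real.exp (-(Real.pi * r) ^ 2 * ‖ξ‖ ^ 2) * ‖fourierMeasure μ ξ‖ ^ 2)
        ≤ ∫⁻ ξ, .ofReal (Real.exp ((m : ℝ) ^ 2 / 4)) * (‖fourierMeasure μ ξ‖ₑ ^ 2 *
            .ofReal (((1 + dist ξ 0 / r⁻¹) ^ m)⁻¹)) := by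
          refine lintegral_mono fun ξ => ?_
          simp only [enorm_sq_eq_ofReal]
          rw [← ENNReal.ofReal_mul (by positivity), ← ENNReal.ofReal_mul (by positivity)]
          apply ENNReal.ofReal_le_ofReal
          have h1 : Real.exp (-(Real.pi * r) ^ 2 * ‖ξ‖ ^ 2) ≤ Real.exp (-(dist ξ 0 / r⁻¹) ^ 2) := by
            rw [Real.exp_le_exp, dist_zero_right, div_inv_eq_mul]
            have : 1 ≤ Real.pi ^ 2 := one_le_pow₀ (by linarith [Real.pi_gt_three])
            have h2 : 0 ≤ (‖ξ‖ * r) ^ 2 := by positivity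
            nlinarith
          have h2 := exp_neg_sq_le_inv_one_add_pow m (t := dist ξ 0 / r⁻¹) (by positivity)
          calc _ ≤ (Real.exp ((m : ℝ) ^ 2 / 4) * ((1 + dist ξ 0 / r⁻¹) ^ m)⁻¹) *
              ‖fourierMeasure μ ξ‖ ^ 2 := by
                exact mul_le_mul_of_nonneg_right (h1.trans h2) (by positivity)
            _ = _ := by ring
      _ ≤ .ofReal (Real.exp ((m : ℝ) ^ 2 / 4)) *
            (.ofReal (2 ^ (β + 1)) * (.ofReal B * .ofReal (r⁻¹ ^ β))) := by
          rw [lintegral_const_mul' _ _ ENNReal.ofReal_ne_top]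
          exact mul_le_mul_right hle _
      _ = _ := by
          have hB : ENNReal.ofReal B = .ofReal (max B 0) := by
            rw [ENNReal.ofReal_max, ENNReal.ofReal_zero, max_eq_left zero_le]
          rw [hB, ← ENNReal.ofReal_mul (by positivity), ← ENNReal.ofReal_mul (by positivity),
            ← ENNReal.ofReal_mul (by positivity), Real.inv_rpow hr.le, ← Real.rpow_neg hr.le, hD]
          congr 1
          ring
  have hpow : (Real.pi / (Real.pi * r) ^ 2) ^ ((k : ℝ) / 2)
      * (Real.pi ^ ((k : ℝ) / 2) * r ^ (k : ℝ)) = 1 := by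
    have h1 : Real.pi / (Real.pi * r) ^ 2 * (Real.pi * r ^ (2 : ℝ)) = 1 := by
      rw [Real.rpow_two]
      field_simp
    rw [show r ^ (k : ℝ) = (r ^ (2 : ℝ)) ^ ((k : ℝ) / 2) by
        rw [← Real.rpow_mul hr.le]; congr 1; ring,
      ← Real.mul_rpow hpi.le (by positivity), ← Real.mul_rpow (by positivity) (by positivity), h1,
      Real.one_rpow]
  have hIJ : I = Real.pi ^ ((k : ℝ) / 2) * r ^ (k : ℝ) * J := by
    rw [hid]
    calc I = ((Real.pi / (Real.pi * r) ^ 2) ^ ((k : ℝ) / 2)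
        * (Real.pi ^ ((k : ℝ) / 2) * r ^ (k : ℝ))) * I := by rw [hpow, one_mul]
      _ = _ := by ring
  calc Real.exp 1 * I ≤ Real.exp 1 * (Real.pi ^ ((k : ℝ) / 2) * r ^ (k : ℝ) * (D * r ^ (-β))) := by
        rw [hIJ]
        gcongr
    _ = _ := by
        rw [sub_eq_add_neg, Real.rpow_add hr]
        ring

/-- A Fourier energy exponent is at most the lower mass exponent of the measure. -/
theorem energy_exponent_le_of_ball_lower_bound (μ : Measure 𝔼) [IsProbabilityMeasure μ]
    {s s' B C : ℝ} (hC : 0 < C)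
    (hlow : ∀ x ∈ μ.support, ∀ r : ℝ, 0 < r → r ≤ 1 → C * r ^ s ≤ μ.real (Metric.ball x r))
    (hμ : ∀ R : ℝ, 0 < R → ∫⁻ ξ in Metric.ball 0 R, ‖fourierMeasure μ ξ‖ₑ ^ 2
      ≤ .ofReal B * .ofReal (R ^ ((k : ℝ) - s'))) : s' ≤ s := by
  obtain ⟨D, hD⟩ := lintegral_measure_closedBall_le_rpow μ hμ
  -- Both sides bound the mean of `μ (closedBall x r)`; letting `r → 0` forces the order of the
  -- exponents.
  have key : ∀ r : ℝ, 0 < r → r ≤ 1 → C * r ^ s ≤ max D 0 * r ^ s' := by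
    intro r hr hr1
    rw [← ENNReal.ofReal_le_ofReal_iff (by positivity)]
    calc ENNReal.ofReal (C * r ^ s) = ∫⁻ _, .ofReal (C * r ^ s) ∂μ := by simp
      _ ≤ ∫⁻ x, μ (Metric.closedBall x r) ∂μ := by
          refine lintegral_mono_ae ?_
          filter_upwards [Measure.support_mem_ae (μ := μ)] with x hx
          rw [ENNReal.ofReal_le_iff_le_toReal (measure_ne_top _ _)]
          exact (hlow x hx r hr hr1).trans
            (measureReal_mono Metric.ball_subset_closedBall)
      _ ≤ _ := hD r hr
      _ ≤ _ := by
          apply ENNReal.ofReal_le_ofReal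
          rw [sub_sub_cancel]
          gcongr
          exact le_max_left _ _
  by_contra! hlt
  have hbound : ∀ r : ℝ, 0 < r → r ≤ 1 → C ≤ max D 0 * r ^ (s' - s) := by
    intro r hr hr1
    rw [Real.rpow_sub hr, mul_div_assoc', le_div_iff₀ (by positivity)]
    exact key r hr hr1
  have hlim : Tendsto (fun r : ℝ => max D 0 * r ^ (s' - s)) (𝓝[>] 0) (𝓝 0) := by
    have h1 : Tendsto (fun r : ℝ => r ^ (s' - s)) (𝓝[>] 0) (𝓝 0) := by
      have := (Real.continuousAt_rpow_const 0 (s' - s) (Or.inr (by linarith))).tendsto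
      rw [Real.zero_rpow (by linarith)] at this
      exact this.mono_left nhdsWithin_le_nhds
    simpa using h1.const_mul (max D 0)
  have : C ≤ 0 := by
    refine ge_of_tendsto hlim ?_
    filter_upwards [Ioc_mem_nhdsGT (zero_lt_one (α := ℝ))] with r hr using hbound r hr.1 hr.2
  linarith

/-- Frostman-type upper bounds give lower bounds for `κ₂`. -/
theorem le_kappaTwo_of_ball_upper_bound (μ : Measure 𝔼) [IsProbabilityMeasure μ] {s A : ℝ}
    (hs0 : 0 ≤ s) (hsk : s < k)
    (hup : ∀ᵐ x ∂μ, ∀ r : ℝ, 0 < r → μ (Metric.ball x r) ≤ .ofReal A * .ofReal (r ^ s)) :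
    s ≤ kappaTwo μ := by
  have hpi := Real.pi_pos
  obtain ⟨m, hm⟩ := exists_nat_ge (s + 1)
  set D := Real.exp ((m : ℝ) ^ 2 / 4) * (2 ^ (s + 1) * max A 0) with hD
  refine le_csSup (bddAbove_kappaTwo_set μ)
    ⟨hs0, hsk, Real.exp 1 * (Real.pi ^ ((k : ℝ) / 2) * D), fun R hR => ?_⟩
  -- With `b = R ^ (-2)` the Gaussian is at least `e⁻¹` on the ball of radius `R`.
  have hid := integral_exp_mul_norm_fourierMeasure_sq μ (b := (R ^ 2)⁻¹) (by positivity)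
  set I := ∫ p : 𝔼 × 𝔼, Real.exp (-(Real.pi ^ 2 / (R ^ 2)⁻¹ * ‖p.1 - p.2‖ ^ 2)) ∂(μ.prod μ)
    with hI
  have hIle : I ≤ D * R ^ (-s) := by
    have hintI : Integrable (fun p : 𝔼 × 𝔼 =>
        Real.exp (-(Real.pi ^ 2 / (R ^ 2)⁻¹ * ‖p.1 - p.2‖ ^ 2))) (μ.prod μ) := by
      refine (integrable_exp_neg_norm_sub_sq μ (b := (R ^ 2)⁻¹ / Real.pi ^ 2)
        (by positivity)).congr (ae_of_all _ fun p => ?_)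
      simp only
      congr 1
      field_simp
    rw [← ENNReal.ofReal_le_ofReal_iff (by positivity), hI,
      ofReal_integral_eq_lintegral_ofReal hintI (ae_of_all _ fun _ => (Real.exp_pos _).le),
      lintegral_prod _ (by fun_prop)]
    calc ∫⁻ x, ∫⁻ y, .ofReal (Real.exp (-(Real.pi ^ 2 / (R ^ 2)⁻¹ * ‖x - y‖ ^ 2))) ∂μ ∂μ
        ≤ ∫⁻ _, .ofReal (D * R ^ (-s)) ∂μ := by
          refine lintegral_mono_ae ?_
          filter_upwards [hup] with x hx
          calc ∫⁻ y, .ofReal (Real.exp (-(Real.pi ^ 2 / (R ^ 2)⁻¹ * ‖x - y‖ ^ 2))) ∂μ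
              ≤ ∫⁻ y, .ofReal (Real.exp ((m : ℝ) ^ 2 / 4)) *
                  .ofReal (((1 + dist y x / R⁻¹) ^ m)⁻¹) ∂μ := by
                refine lintegral_mono fun y => ?_
                rw [← ENNReal.ofReal_mul (by positivity)]
                apply ENNReal.ofReal_le_ofReal
                refine le_trans ?_ (exp_neg_sq_le_inv_one_add_pow m (t := dist y x / R⁻¹)
                  (by positivity))
                rw [Real.exp_le_exp, dist_comm, dist_eq_norm, div_inv_eq_mul, div_inv_eq_mul]
                have : 1 ≤ Real.pi ^ 2 := one_le_pow₀ (by linarith [Real.pi_gt_three])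
                have h2 : 0 ≤ (‖x - y‖ * R) ^ 2 := by positivity
                nlinarith
            _ ≤ .ofReal (Real.exp ((m : ℝ) ^ 2 / 4)) *
                  (.ofReal (2 ^ (s + 1)) * (.ofReal A * .ofReal (R⁻¹ ^ s))) := by
                rw [lintegral_const_mul' _ _ ENNReal.ofReal_ne_top]
                exact mul_le_mul_right
                  (lintegral_inv_one_add_dist_pow_le μ hm x hx (inv_pos.2 hR)) _
            _ = _ := by
                have hB : ENNReal.ofReal A = .ofReal (max A 0) := by
                  rw [ENNReal.ofReal_max, ENNReal.ofReal_zero, max_eq_left zero_le]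
                rw [hB, ← ENNReal.ofReal_mul (by positivity), ← ENNReal.ofReal_mul (by positivity),
                  ← ENNReal.ofReal_mul (by positivity), Real.inv_rpow hR.le, ← Real.rpow_neg hR.le,
                  hD]
                congr 1
                ring
      _ = _ := by simp
  calc ∫ ξ in Metric.ball (0 : 𝔼) R, ‖fourierMeasure μ ξ‖ ^ 2
      ≤ ∫ ξ in Metric.ball (0 : 𝔼) R, Real.exp 1 *
          (Real.exp (-(R ^ 2)⁻¹ * ‖ξ‖ ^ 2) * ‖fourierMeasure μ ξ‖ ^ 2) := by
        refine setIntegral_mono_on (integrableOn_ball_norm_fourierMeasure_sq μ R)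
          ((integrable_exp_mul_norm_fourierMeasure_sq μ (by positivity)).const_mul _).integrableOn
          measurableSet_ball fun ξ hξ => ?_
        rw [← mul_assoc, ← Real.exp_add]
        refine le_mul_of_one_le_left (by positivity) (Real.one_le_exp ?_)
        have h1 : ‖ξ‖ < R := by simpa using hξ
        have : (R ^ 2)⁻¹ * ‖ξ‖ ^ 2 ≤ 1 := by
          rw [inv_mul_le_iff₀ (by positivity)]
          nlinarith [norm_nonneg ξ]
        linarith
    _ ≤ ∫ ξ, Real.exp 1 * (Real.exp (-(R ^ 2)⁻¹ * ‖ξ‖ ^ 2) * ‖fourierMeasure μ ξ‖ ^ 2) :=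
        setIntegral_le_integral
          ((integrable_exp_mul_norm_fourierMeasure_sq μ (by positivity)).const_mul _)
          (ae_of_all _ fun _ => by positivity)
    _ = Real.exp 1 * ((Real.pi / (R ^ 2)⁻¹) ^ ((k : ℝ) / 2) * I) := by
        rw [integral_const_mul, hid]
    _ ≤ Real.exp 1 * ((Real.pi / (R ^ 2)⁻¹) ^ ((k : ℝ) / 2) * (D * R ^ (-s))) := by gcongr
    _ = _ := by
        rw [div_inv_eq_mul, Real.mul_rpow hpi.le (by positivity), ← Real.rpow_two,
          ← Real.rpow_mul hR.le, sub_eq_add_neg, Real.rpow_add hR,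
          show (2 : ℝ) * ((k : ℝ) / 2) = k by ring]
        ring

theorem measure_ball_le_of_le_one {X : Type*} [PseudoMetricSpace X] [MeasurableSpace X]
    (μ : Measure X) [IsProbabilityMeasure μ] {s C : ℝ} (hs : 0 ≤ s) (hC : 1 ≤ C) {x : X}
    (h : ∀ r : ℝ, 0 < r → r ≤ 1 → μ.real (Metric.ball x r) ≤ C * r ^ s) {r : ℝ} (hr : 0 < r) :
    μ (Metric.ball x r) ≤ .ofReal C * .ofReal (r ^ s) := by
  rw [← ENNReal.ofReal_mul (by linarith)]
  rcases le_total r 1 with h1 | h1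
  · rw [ENNReal.le_ofReal_iff_toReal_le (measure_ne_top _ _) (by positivity)]
    exact h r hr h1
  · refine prob_le_one.trans (ENNReal.one_le_ofReal.2 ?_)
    exact one_le_mul_of_one_le_of_one_le hC (Real.one_le_rpow h1 hs)

end Energy

/-! ### The gradient map and Taylor expansion. -/

section Gradient

variable {k : ℕ}

local notation "𝔼" => EuclideanSpace ℝ (Fin k)

theorem injective_fderiv_fderiv_of_det_ne_zero {f : 𝔼 → ℝ} {x : 𝔼}
    (hH : (hessianMatrix f x).det ≠ 0) : Function.Injective (fderiv ℝ (fderiv ℝ f) x) := by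
  rw [injective_iff_map_eq_zero]
  intro v hv
  have h0 : (fun i => v i) = 0 := by
    refine Matrix.eq_zero_of_vecMul_eq_zero hH ?_
    ext j
    have h1 : fderiv ℝ (fderiv ℝ f) x v (EuclideanSpace.single j 1) = 0 := by rw [hv]; rfl
    have h2 : v = ∑ i, v i • EuclideanSpace.single i (1 : ℝ) := by
      ext j
      simp [Finset.sum_apply, Pi.single_apply]
    rw [h2] at h1
    simp only [map_sum, map_smul, sum_apply, smul_apply,
      smul_eq_mul] at h1
    simp only [Matrix.vecMul, dotProduct, hessianMatrix, Matrix.of_apply,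
      iteratedFDeriv_two_apply, Matrix.cons_val_zero, Matrix.cons_val_one, Pi.zero_apply]
    exact h1
  ext i
  exact congrFun h0 i

/-- Quantitative inverse function theorem: the injective derivative expands by at least `K⁻¹`, and
strict differentiability makes the linearization error at most half of that, whence `c = 2 * K`. -/
theorem exists_antilipschitz_nhds_gradient {f : 𝔼 → ℝ} (hf : ContDiff ℝ ∞ f) {x : 𝔼}
    (hH : (hessianMatrix f x).det ≠ 0) :
    ∃ U ∈ 𝓝 x, ∃ c : ℝ, 0 < c ∧ ∀ y ∈ U, ∀ z ∈ U, dist y z ≤ c * dist (gradient f y) (gradient f z)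
    := by
  have hstrict : HasStrictFDerivAt (fderiv ℝ f) (fderiv ℝ (fderiv ℝ f) x) x := by
    have : ContDiff ℝ 1 (fderiv ℝ f) := hf.fderiv_right (by norm_cast)
    exact this.contDiffAt.hasStrictFDerivAt (by norm_num)
  obtain ⟨K, hK, hanti⟩ := LinearMap.exists_antilipschitzWith
    ((fderiv ℝ (fderiv ℝ f) x : 𝔼 →L[ℝ] 𝔼 →L[ℝ] ℝ) : 𝔼 →ₗ[ℝ] 𝔼 →L[ℝ] ℝ)
    (LinearMap.ker_eq_bot.2 (injective_fderiv_fderiv_of_det_ne_zero hH))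
  obtain ⟨U, hU, happ⟩ := hstrict.approximates_deriv_on_nhds (c := K⁻¹ / 2)
    (Or.inr (by positivity))
  refine ⟨U, hU, 2 * K, by positivity, fun y hy z hz => ?_⟩
  have h1 := happ y hy z hz
  have h2 : ‖y - z‖ ≤ K * ‖fderiv ℝ (fderiv ℝ f) x (y - z)‖ := by
    have := hanti.le_mul_dist (y - z) 0
    simpa using this
  have h3 : dist (gradient f y) (gradient f z) = ‖fderiv ℝ f y - fderiv ℝ f z‖ := by
    rw [gradient, gradient, LinearIsometryEquiv.dist_map, dist_eq_norm]
  rw [h3, dist_eq_norm]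
  have hK' : (0 : ℝ) < K := hK
  have h4 := norm_sub_norm_le (fderiv ℝ (fderiv ℝ f) x (y - z))
    (fderiv ℝ (fderiv ℝ f) x (y - z) - (fderiv ℝ f y - fderiv ℝ f z))
  rw [sub_sub_cancel, norm_sub_rev (fderiv ℝ (fderiv ℝ f) x (y - z))] at h4
  push_cast at h1
  have h5 : (K : ℝ) * ((K : ℝ)⁻¹ / 2 * ‖y - z‖) = ‖y - z‖ / 2 := by field_simp
  nlinarith [mul_le_mul_of_nonneg_left h1 hK'.le, mul_le_mul_of_nonneg_left h4 hK'.le]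

theorem continuous_gradient {f : 𝔼 → ℝ} (hf : ContDiff ℝ ∞ f) : Continuous (gradient f) :=
  (LinearIsometryEquiv.continuous _).comp (hf.continuous_fderiv (by simp))

/-- The image under `∇f` of a Frostman measure is a Frostman measure with the same exponent. -/
theorem exists_map_gradient_ball_le {f : 𝔼 → ℝ} (hf : ContDiff ℝ ∞ f)
    (hH : ∀ x, (hessianMatrix f x).det ≠ 0) (μ : Measure 𝔼) [IsProbabilityMeasure μ]
    (hK : IsCompact μ.support) {s A : ℝ}
    (hup : ∀ x ∈ μ.support, ∀ r : ℝ, 0 < r → μ (Metric.ball x r) ≤ .ofReal A * .ofReal (r ^ s)) :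
    ∃ A' : ℝ, ∀ c, ∀ ρ : ℝ, 0 < ρ →
      μ.map (gradient f) (Metric.ball c ρ) ≤ .ofReal A' * .ofReal (ρ ^ s) := by
  choose U hU a ha hUa using fun x => exists_antilipschitz_nhds_gradient hf (hH x)
  obtain ⟨t, -, ht⟩ := hK.elim_nhds_subcover U fun x _ => hU x
  refine ⟨∑ x ∈ t, max A 0 * (3 * a x) ^ s, fun c ρ hρ => ?_⟩
  rw [Measure.map_apply (continuous_gradient hf).measurable measurableSet_ball]
  have hae : μ (gradient f ⁻¹' Metric.ball c ρ)
      = μ (gradient f ⁻¹' Metric.ball c ρ ∩ μ.support) :=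
    (measure_inter_conull Measure.measure_compl_support).symm
  have hsub : gradient f ⁻¹' Metric.ball c ρ ∩ μ.support
      ⊆ ⋃ x ∈ t, (gradient f ⁻¹' Metric.ball c ρ ∩ μ.support) ∩ U x := by
    intro y hy
    obtain ⟨x, hx, hyx⟩ := Set.mem_iUnion₂.1 (ht hy.2)
    exact Set.mem_iUnion₂.2 ⟨x, hx, hy, hyx⟩
  have hpiece : ∀ x, μ ((gradient f ⁻¹' Metric.ball c ρ ∩ μ.support) ∩ U x)
      ≤ .ofReal (max A 0 * (3 * a x) ^ s * ρ ^ s) := by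
    intro x
    rcases ((gradient f ⁻¹' Metric.ball c ρ ∩ μ.support) ∩ U x).eq_empty_or_nonempty with h | ⟨y, hy⟩
    · rw [h, measure_empty]; exact zero_le
    · have hax := ha x
      -- The gradients at `z` and `y` differ by less than `2ρ`, so `z` is within `2 a ρ` of `y`. The
      -- centre `y` is taken in the support, where the ball bound is assumed.
      calc _ ≤ μ (Metric.ball y (3 * a x * ρ)) := by
            refine measure_mono fun z hz => ?_
            have h1 : dist (gradient f z) c < ρ := hz.1.1
            have h2 : dist (gradient f y) c < ρ := hy.1.1
            have h3 := hUa x z hz.2 y hy.2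
            have h4 := dist_triangle_right (gradient f z) (gradient f y) c
            rw [Metric.mem_ball]
            nlinarith
        _ ≤ .ofReal A * .ofReal ((3 * a x * ρ) ^ s) := hup y hy.1.2 _ (by positivity)
        _ ≤ .ofReal (max A 0) * .ofReal ((3 * a x * ρ) ^ s) := by
            gcongr
            exact le_max_left _ _
        _ = _ := by
            rw [← ENNReal.ofReal_mul (le_max_right _ _), Real.mul_rpow (by positivity) hρ.le,
              mul_assoc]
  have hnn : ∀ x ∈ t, 0 ≤ max A 0 * (3 * a x) ^ s := fun x _ => by
    have := ha x
    positivity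
  calc _ = μ (gradient f ⁻¹' Metric.ball c ρ ∩ μ.support) := hae
    _ ≤ μ (⋃ x ∈ t, (gradient f ⁻¹' Metric.ball c ρ ∩ μ.support) ∩ U x) := measure_mono hsub
    _ ≤ ∑ x ∈ t, μ ((gradient f ⁻¹' Metric.ball c ρ ∩ μ.support) ∩ U x) :=
        measure_biUnion_finset_le _ _
    _ ≤ ∑ x ∈ t, .ofReal (max A 0 * (3 * a x) ^ s * ρ ^ s) :=
        Finset.sum_le_sum fun x _ => hpiece x
    _ = _ := by
        rw [← ENNReal.ofReal_mul (Finset.sum_nonneg hnn), Finset.sum_mul,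
          ENNReal.ofReal_sum_of_nonneg fun x hx => mul_nonneg (hnn x hx) (by positivity)]

/-- Second-order Taylor bound on a ball. -/
theorem exists_taylor_bound {f : 𝔼 → ℝ} (hf : ContDiff ℝ ∞ f) (L : ℝ) :
    ∃ C : ℝ, 0 ≤ C ∧ ∀ x y : 𝔼, ‖x‖ ≤ L → ‖y‖ ≤ L →
      |f y - f x - inner ℝ (gradient f x) (y - x)| ≤ C * ‖y - x‖ ^ 2 := by
  have hc1 : ContDiff ℝ 1 (fderiv ℝ f) := hf.fderiv_right (by norm_cast)
  obtain ⟨C, hC⟩ := (isCompact_closedBall (0 : 𝔼) L).exists_bound_of_continuousOn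
    (hc1.continuous_fderiv (by norm_num)).continuousOn
  refine ⟨max C 0, le_max_right _ _, fun x y hx hy => ?_⟩
  have hconv := convex_closedBall (0 : 𝔼) L
  have hlip : ∀ z ∈ Metric.closedBall (0 : 𝔼) L, ‖fderiv ℝ f z - fderiv ℝ f x‖
      ≤ max C 0 * ‖z - x‖ := fun z hz =>
    hconv.norm_image_sub_le_of_norm_fderiv_le
      (fun w _ => (hc1.differentiable (by norm_num)).differentiableAt)
      (fun w hw => (hC w hw).trans (le_max_left _ _)) (by simpa using hx) hz
  -- Mean value inequality on the segment, where the derivative is within `C ‖y - x‖` of its value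
  -- at `x`.
  have h := (convex_segment x y).norm_image_sub_le_of_norm_fderiv_le' (f := f) (x := x) (y := y)
    (φ := fderiv ℝ f x) (C := max C 0 * ‖y - x‖)
    (fun w _ => (hf.differentiable (by simp)).differentiableAt)
    (fun w hw => by
      refine (hlip w (hconv.segment_subset (by simpa using hx) (by simpa using hy) hw)).trans ?_
      gcongr
      obtain ⟨θ, hθ, rfl⟩ := (segment_eq_image' ℝ x y ▸ hw : w ∈ _)
      simp only [add_sub_cancel_left, norm_smul, Real.norm_of_nonneg hθ.1]
      exact mul_le_of_le_one_left (norm_nonneg _) hθ.2)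
    (left_mem_segment _ _ _) (right_mem_segment _ _ _)
  rw [Real.norm_eq_abs] at h
  have hin : inner ℝ (gradient f x) (y - x) = fderiv ℝ f x (y - x) := by
    rw [gradient, InnerProductSpace.toDual_symm_apply]
  rw [hin]
  calc _ ≤ _ := h
    _ = _ := by ring

end Gradient

/-! ### Words and stopping at a given ratio. -/

namespace SelfSimilarIFS

variable {k N : ℕ} (Λ : SelfSimilarIFS k N)

/-- The contraction ratio of the composition along a word. -/
noncomputable def wordRatio (w : List (Fin N)) : ℝ := (w.map Λ.ratio).prod

/-- The orthogonal part of the composition along a word. -/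
noncomputable def wordRot (w : List (Fin N)) : EuclideanSpace ℝ (Fin k) ≃ₗᵢ[ℝ] EuclideanSpace ℝ (Fin k) :=
  (w.map Λ.rot).prod

/-- The composition of the maps of the system along a word. -/
noncomputable def wordMap : List (Fin N) → EuclideanSpace ℝ (Fin k) → EuclideanSpace ℝ (Fin k)
  | [] => id
  | i :: w => Λ.map i ∘ wordMap w

theorem wordMap_append (u v : List (Fin N)) :
    Λ.wordMap (u ++ v) = Λ.wordMap u ∘ Λ.wordMap v := by
  induction u with
  | nil => rfl
  | cons i u ih => simp only [List.cons_append, wordMap, ih, Function.comp_assoc]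

theorem map_sub_map (i : Fin N) (x y : EuclideanSpace ℝ (Fin k)) :
    Λ.map i y - Λ.map i x = Λ.ratio i • Λ.rot i (y - x) := by
  simp [map, map_sub, smul_sub]

theorem wordMap_sub_wordMap (w : List (Fin N)) (x y : EuclideanSpace ℝ (Fin k)) :
    Λ.wordMap w y - Λ.wordMap w x = Λ.wordRatio w • Λ.wordRot w (y - x) := by
  induction w with
  | nil => simp [wordMap, wordRatio, wordRot]
  | cons i w ih =>
    simp only [wordMap, Function.comp_apply, map_sub_map, ih, wordRatio, wordRot, List.map_cons,
      List.prod_cons, LinearIsometryEquiv.coe_mul, map_smul, smul_smul]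

theorem continuous_map (i : Fin N) : Continuous (Λ.map i) := by
  have := (Λ.rot i).continuous
  unfold map
  fun_prop

theorem continuous_wordMap (w : List (Fin N)) : Continuous (Λ.wordMap w) := by
  induction w with
  | nil => exact continuous_id
  | cons i w ih => exact (Λ.continuous_map i).comp ih

theorem wordRatio_pos (w : List (Fin N)) : 0 < Λ.wordRatio w := by
  refine List.prod_pos fun a ha => ?_
  obtain ⟨i, -, rfl⟩ := List.mem_map.1 ha
  exact Λ.ratio_pos i

theorem wordRatio_append (u v : List (Fin N)) :
    Λ.wordRatio (u ++ v) = Λ.wordRatio u * Λ.wordRatio v := by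
  simp [wordRatio]

theorem mapsTo_wordMap {K : Set (EuclideanSpace ℝ (Fin k))} (hK : ∀ i, Set.MapsTo (Λ.map i) K K)
    (w : List (Fin N)) : Set.MapsTo (Λ.wordMap w) K K := by
  induction w with
  | nil => exact Set.mapsTo_id K
  | cons i w ih => exact (hK i).comp ih

theorem exists_ratio_bounds : ∃ a b : ℝ, 0 < a ∧ a ≤ 1 ∧ 0 < b ∧ b < 1 ∧
    ∀ i, a ≤ Λ.ratio i ∧ Λ.ratio i ≤ b := by
  have : Nonempty (Fin N) := ⟨⟨0, by linarith [Λ.one_lt]⟩⟩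
  obtain ⟨i, hi⟩ := Finite.exists_min Λ.ratio
  obtain ⟨j, hj⟩ := Finite.exists_max Λ.ratio
  exact ⟨Λ.ratio i, Λ.ratio j, Λ.ratio_pos i, (Λ.ratio_lt_one i).le, Λ.ratio_pos j,
    Λ.ratio_lt_one j, fun l => ⟨hi l, hj l⟩⟩

theorem wordRatio_le_pow {b : ℝ} (hb : ∀ i, Λ.ratio i ≤ b) (w : List (Fin N)) :
    Λ.wordRatio w ≤ b ^ w.length := by
  induction w with
  | nil => simp [wordRatio]
  | cons i w ih =>
    have h1 := Λ.wordRatio_pos w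
    have h2 := Λ.ratio_pos i
    have h3 : (0 : ℝ) ≤ b := h2.le.trans (hb i)
    have : Λ.wordRatio (i :: w) = Λ.ratio i * Λ.wordRatio w := by simp [wordRatio]
    rw [this, List.length_cons, pow_succ']
    exact mul_le_mul (hb i) ih h1.le h3

open Classical in
/-- The words obtained from the empty word by `n` rounds of extending those words whose ratio
exceeds `r`. -/
noncomputable def stopping (r : ℝ) : ℕ → Multiset (List (Fin N))
  | 0 => {[]}
  | n + 1 => (stopping r n).bind fun w =>
      if Λ.wordRatio w ≤ r then {w} else Finset.univ.val.map fun i => w ++ [i]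

/-- A word is extended only while its ratio exceeds `r`, so the last letter brings it no lower than
`a * r`; a word that has not stopped gained a letter in every round. -/
theorem mem_stopping {r a : ℝ} (hr : r ≤ 1) (ha : ∀ i, a ≤ Λ.ratio i) (ha0 : 0 < a) (ha1 : a ≤ 1)
    {n : ℕ} :
    ∀ w ∈ Λ.stopping r n, w.length ≤ n ∧ a * r ≤ Λ.wordRatio w ∧
      (Λ.wordRatio w ≤ r ∨ w.length = n) := by
  induction n with
  | zero =>
    intro w hw
    rw [stopping, Multiset.mem_singleton] at hw
    subst hw
    simp only [List.length_nil, le_refl, or_true, and_true, true_and, wordRatio, List.map_nil,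
      List.prod_nil]
    nlinarith
  | succ n ih =>
    intro w hw
    rw [stopping, Multiset.mem_bind] at hw
    obtain ⟨v, hv, hw⟩ := hw
    obtain ⟨h1, h2, h3⟩ := ih v hv
    split_ifs at hw with hvr
    · rw [Multiset.mem_singleton] at hw
      subst hw
      exact ⟨h1.trans (Nat.le_succ n), h2, Or.inl hvr⟩
    · obtain ⟨i, -, rfl⟩ := Multiset.mem_map.1 hw
      have hlen : v.length = n := h3.resolve_left hvr
      refine ⟨by simp [hlen], ?_, Or.inr (by simp [hlen])⟩
      rw [wordRatio_append, mul_comm a r]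
      have : Λ.wordRatio [i] = Λ.ratio i := by simp [wordRatio]
      rw [this]
      exact mul_le_mul (not_le.1 hvr).le (ha i) ha0.le (Λ.wordRatio_pos v).le

theorem wordRatio_le_of_mem_stopping {r a b : ℝ} (hr : r ≤ 1) (ha : ∀ i, a ≤ Λ.ratio i)
    (ha0 : 0 < a) (ha1 : a ≤ 1) (hb : ∀ i, Λ.ratio i ≤ b) {n : ℕ} (hn : b ^ n ≤ r)
    {w : List (Fin N)} (hw : w ∈ Λ.stopping r n) : Λ.wordRatio w ≤ r := by
  rcases (Λ.mem_stopping hr ha ha0 ha1 w hw).2.2 with h | h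
  · exact h
  · exact (Λ.wordRatio_le_pow hb w).trans (h ▸ hn)

/-- An inequality valid for one splitting propagates down the stopped tree. This direction serves
Jensen's inequality; its companion `sum_stopping_le` reassembles integrals. -/
theorem le_sum_stopping {M : Type*} [AddCommMonoid M] [PartialOrder M] [IsOrderedAddMonoid M]
    (r : ℝ) (G : List (Fin N) → M) (hG : ∀ w, G w ≤ ∑ i, G (w ++ [i])) (n : ℕ) :
    G [] ≤ ((Λ.stopping r n).map G).sum := by
  induction n with
  | zero => simp [stopping]
  | succ n ih =>
    refine ih.trans ?_
    rw [stopping, Multiset.map_bind, Multiset.sum_bind]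
    refine Multiset.sum_map_le_sum_map _ _ fun w _ => ?_
    split_ifs
    · simp
    · rw [Multiset.map_map]
      exact hG w

theorem sum_stopping_le {M : Type*} [AddCommMonoid M] [PartialOrder M] [IsOrderedAddMonoid M]
    (r : ℝ) (G : List (Fin N) → M) (hG : ∀ w, ∑ i, G (w ++ [i]) ≤ G w) (n : ℕ) :
    ((Λ.stopping r n).map G).sum ≤ G [] := by
  induction n with
  | zero => simp [stopping]
  | succ n ih =>
    refine le_trans ?_ ih
    rw [stopping, Multiset.map_bind, Multiset.sum_bind]
    refine Multiset.sum_map_le_sum_map _ _ fun w _ => ?_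
    split_ifs
    · simp
    · rw [Multiset.map_map]
      exact hG w

theorem exists_mem_stopping {E : Set (EuclideanSpace ℝ (Fin k))} (hE : E = ⋃ i, Λ.map i '' E)
    (r : ℝ) (n : ℕ) {x : EuclideanSpace ℝ (Fin k)} (hx : x ∈ E) :
    ∃ w ∈ Λ.stopping r n, x ∈ Λ.wordMap w '' E := by
  induction n with
  | zero => exact ⟨[], by simp [stopping], by simpa [wordMap] using hx⟩
  | succ n ih =>
    obtain ⟨w, hw, y, hy, rfl⟩ := ih
    by_cases h : Λ.wordRatio w ≤ r
    · exact ⟨w, by rw [stopping, Multiset.mem_bind]; exact ⟨w, hw, by simp [h]⟩, y, hy, rfl⟩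
    · rw [hE] at hy
      obtain ⟨i, z, hz, rfl⟩ := Set.mem_iUnion.1 hy
      refine ⟨w ++ [i], ?_, z, hz, by rw [wordMap_append]; rfl⟩
      rw [stopping, Multiset.mem_bind]
      exact ⟨w, hw, by simp [h]⟩

theorem wordRot_mem_pow (w : List (Fin N)) : Λ.wordRot w ∈ Set.range Λ.rot ^ w.length := by
  induction w with
  | nil => simp [wordRot]
  | cons i w ih =>
    have : Λ.wordRot (i :: w) = Λ.rot i * Λ.wordRot w := by simp [wordRot]
    rw [this, List.length_cons, pow_succ']
    exact Set.mul_mem_mul ⟨i, rfl⟩ ih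

end SelfSimilarIFS

/-! ### Counting the linear parts. -/

theorem exists_natCast_add_one_pow_le_exp (m : ℕ) {ε : ℝ} (hε : 0 < ε) :
    ∃ C : ℝ, 0 ≤ C ∧ ∀ n : ℕ, ((n : ℝ) + 1) ^ m ≤ C * Real.exp (ε * n) := by
  -- `δ ≤ 1` gives `δ (n + 1) ≤ δ n + 1 ≤ exp (δ n)`, and `m δ ≤ ε` keeps the rate after the `m`-th
  -- power.
  set δ := min 1 (ε / (m + 1)) with hδ
  have hδ0 : 0 < δ := by positivity
  refine ⟨(δ⁻¹) ^ m, by positivity, fun n => ?_⟩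
  have h1 : (n : ℝ) + 1 ≤ δ⁻¹ * Real.exp (δ * n) := by
    rw [inv_mul_eq_div, le_div_iff₀ hδ0]
    have := Real.add_one_le_exp (δ * n)
    have h2 : δ ≤ 1 := min_le_left _ _
    nlinarith
  calc ((n : ℝ) + 1) ^ m ≤ (δ⁻¹ * Real.exp (δ * n)) ^ m := by gcongr
    _ = δ⁻¹ ^ m * Real.exp (m * (δ * n)) := by rw [mul_pow, ← Real.exp_nat_mul]
    _ ≤ _ := by
        refine mul_le_mul_of_nonneg_left (Real.exp_le_exp.2 ?_) (by positivity)
        have h2 : δ ≤ ε / (m + 1) := min_le_right _ _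
        rw [le_div_iff₀ (by positivity)] at h2
        have h3 : (0 : ℝ) ≤ n := Nat.cast_nonneg n
        have h4 : (m : ℝ) * δ ≤ ε := by nlinarith
        rw [← mul_assoc]
        exact mul_le_mul_of_nonneg_right h4 h3

/-- Stopped words have varying lengths, so all lengths up to `n` are gathered; the extra factor `n +
1` is absorbed by half of `ε`. -/
theorem NonExpanding.exists_finset_card_le {G : Type*} [Group G] {F : Set G} (hF : NonExpanding F)
    {ε : ℝ} (hε : 0 < ε) : ∃ C : ℝ, 0 ≤ C ∧ ∀ n : ℕ, ∃ T : Finset G,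
      (∀ m ≤ n, F ^ m ⊆ T) ∧ (T.card : ℝ) ≤ C * Real.exp (ε * n) := by
  classical
  obtain ⟨C₁, hC₁⟩ := hF.2 (ε / 2) (by positivity)
  obtain ⟨C₂, hC₂0, hC₂⟩ := exists_natCast_add_one_pow_le_exp 1 (ε := ε / 2) (by positivity)
  have hfin : ∀ m : ℕ, (F ^ m).Finite := by
    intro m
    induction m with
    | zero => simp
    | succ m ih => rw [pow_succ]; exact ih.mul hF.1
  refine ⟨C₂ * max C₁ 0, by positivity, fun n =>
    ⟨(Finset.range (n + 1)).biUnion fun m => (hfin m).toFinset, fun m hm x hx => ?_, ?_⟩⟩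
  · simp only [Finset.coe_biUnion, Set.Finite.coe_toFinset, Set.mem_iUnion]
    exact ⟨m, by simpa using Nat.lt_succ_of_le hm, hx⟩
  · calc (((Finset.range (n + 1)).biUnion fun m => (hfin m).toFinset).card : ℝ)
        ≤ ∑ m ∈ Finset.range (n + 1), ((hfin m).toFinset.card : ℝ) := by
          exact_mod_cast Finset.card_biUnion_le
      _ ≤ ∑ m ∈ Finset.range (n + 1), max C₁ 0 * Real.exp (ε / 2 * n) := by
          refine Finset.sum_le_sum fun m hm => ?_
          rw [← Set.ncard_eq_toFinset_card _ (hfin m)]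
          refine (hC₁ m).trans ?_
          gcongr
          · exact le_max_left _ _
          · exact Nat.lt_succ_iff.1 (Finset.mem_range.1 hm)
      _ = ((n : ℝ) + 1) ^ 1 * (max C₁ 0 * Real.exp (ε / 2 * n)) := by simp
      _ ≤ C₂ * Real.exp (ε / 2 * n) * (max C₁ 0 * Real.exp (ε / 2 * n)) := by
          gcongr
          exact hC₂ n
      _ = C₂ * max C₁ 0 * (Real.exp (ε / 2 * n) * Real.exp (ε / 2 * n)) := by ring
      _ = _ := by rw [← Real.exp_add]; congr 2; ring

namespace SelfSimilarIFS

variable {k N : ℕ} (Λ : SelfSimilarIFS k N)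

/-- A non-expanding system has subexponentially many linear parts. -/
theorem IsNonExpanding.exists_finset_linear_parts {Λ : SelfSimilarIFS k N} (hΛ : Λ.IsNonExpanding)
    {ε : ℝ} (hε : 0 < ε) : ∃ C : ℝ, 0 ≤ C ∧ ∀ n : ℕ,
      ∃ T : Finset (ℝ × (EuclideanSpace ℝ (Fin k) ≃ₗᵢ[ℝ] EuclideanSpace ℝ (Fin k))),
      (∀ w : List (Fin N), w.length ≤ n → (Λ.wordRatio w, Λ.wordRot w) ∈ T) ∧
        (T.card : ℝ) ≤ C * Real.exp (ε * n) := by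
  classical
  obtain ⟨C₁, hC₁0, hC₁⟩ := NonExpanding.exists_finset_card_le hΛ (ε := ε / 2) (by positivity)
  obtain ⟨C₂, hC₂0, hC₂⟩ := exists_natCast_add_one_pow_le_exp N (ε := ε / 2) (by positivity)
  refine ⟨C₂ * C₁, by positivity, fun n => ?_⟩
  obtain ⟨T, hT, hTc⟩ := hC₁ n
  -- Ratios commute: the ratio of a word depends only on its letter counts, leaving at most `(n + 1)
  -- ^ N` values.
  set S : Finset ℝ := Finset.univ.image fun c : Fin N → Fin (n + 1) =>
    ∏ i, Λ.ratio i ^ (c i : ℕ) with hS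
  refine ⟨S ×ˢ T, fun w hw => Finset.mem_product.2 ⟨?_, hT _ hw (Λ.wordRot_mem_pow w)⟩, ?_⟩
  · refine Finset.mem_image.2 ⟨fun i => ⟨w.count i, Nat.lt_succ_of_le
      (List.count_le_length.trans hw)⟩, Finset.mem_univ _, ?_⟩
    rw [wordRatio, Finset.prod_list_map_count]
    refine (Finset.prod_subset (Finset.subset_univ w.toFinset) fun i _ hi => ?_).symm
    rw [List.mem_toFinset] at hi
    simp only [List.count_eq_zero_of_not_mem hi, pow_zero]
  · have hScard : (S.card : ℝ) ≤ ((n : ℝ) + 1) ^ N := by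
      have : S.card ≤ (n + 1) ^ N := by
        refine Finset.card_image_le.trans ?_
        simp
      exact_mod_cast this
    rw [Finset.card_product]
    push_cast
    calc (S.card : ℝ) * T.card ≤ (C₂ * Real.exp (ε / 2 * n)) * (C₁ * Real.exp (ε / 2 * n)) := by
          gcongr
          exact hScard.trans (hC₂ n)
      _ = C₂ * C₁ * (Real.exp (ε / 2 * n) * Real.exp (ε / 2 * n)) := by ring
      _ = _ := by rw [← Real.exp_add]; congr 2; ring

section Stationary

variable {Λ} {p : Fin N → ℝ} {μ : Measure (EuclideanSpace ℝ (Fin k))}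

theorem IsStationary.lintegral_eq (h : Λ.IsStationary p μ) {g : EuclideanSpace ℝ (Fin k) → ℝ≥0∞}
    (hg : Measurable g) :
    ∫⁻ x, g x ∂μ = ∑ i, .ofReal (p i) * ∫⁻ x, g (Λ.map i x) ∂μ := by
  conv_lhs => rw [h.2.2]
  rw [lintegral_finsetSum_measure]
  refine Finset.sum_congr rfl fun i _ => ?_
  rw [lintegral_smul_measure, lintegral_map hg (Λ.continuous_map i).measurable, smul_eq_mul]

theorem IsStationary.integral_eq (h : Λ.IsStationary p μ) (hp : ∀ i, 0 ≤ p i)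
    {g : EuclideanSpace ℝ (Fin k) → ℂ} (hg : Continuous g) {C : ℝ} (hC : ∀ x, ‖g x‖ ≤ C) :
    ∫ x, g x ∂μ = ∑ i, (p i : ℂ) * ∫ x, g (Λ.map i x) ∂μ := by
  have := h.1
  conv_lhs => rw [h.2.2]
  have hint : ∀ ν : Measure (EuclideanSpace ℝ (Fin k)), IsFiniteMeasure ν → Integrable g ν :=
    fun ν _ => (integrable_const C).mono' hg.aestronglyMeasurable (ae_of_all _ hC)
  rw [integral_finsetSum_measure fun i _ =>
    (hint _ inferInstance).smul_measure ENNReal.ofReal_ne_top]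
  refine Finset.sum_congr rfl fun i _ => ?_
  rw [integral_smul_measure, integral_map (Λ.continuous_map i).aemeasurable
    hg.aestronglyMeasurable, ENNReal.toReal_ofReal (hp i), Complex.real_smul]

theorem IsStationary.sum_stopping_lintegral_le (h : Λ.IsStationary p μ)
    {g : EuclideanSpace ℝ (Fin k) → ℝ≥0∞} (hg : Measurable g) (r : ℝ) (n : ℕ) :
    ((Λ.stopping r n).map fun w => (w.map fun i => ENNReal.ofReal (p i)).prod *
      ∫⁻ x, g (Λ.wordMap w x) ∂μ).sum ≤ ∫⁻ x, g x ∂μ := by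
  refine (Λ.sum_stopping_le r _ (fun w => le_of_eq ?_) n).trans (by simp [wordMap])
  have h1 := h.lintegral_eq (hg.comp (Λ.continuous_wordMap w).measurable)
  simp only [Function.comp_apply] at h1
  rw [h1, Finset.mul_sum]
  refine Finset.sum_congr rfl fun i _ => ?_
  simp only [List.map_append, List.map_cons, List.map_nil, List.prod_append, List.prod_singleton,
    wordMap_append, mul_assoc]
  rfl

/-- Stationarity writes the integral as a convex combination over the children of a word; Jensen's
inequality for the square applies at each splitting. -/
theorem IsStationary.enorm_integral_sq_le_sum_stopping (h : Λ.IsStationary p μ)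
    (hp : ∀ i, 0 ≤ p i) (hp1 : ∑ i, p i = 1)
    {g : EuclideanSpace ℝ (Fin k) → ℂ} (hg : Continuous g) {C : ℝ} (hC : ∀ x, ‖g x‖ ≤ C)
    (r : ℝ) (n : ℕ) :
    ‖∫ x, g x ∂μ‖ₑ ^ 2 ≤ ((Λ.stopping r n).map fun w =>
      (w.map fun i => ENNReal.ofReal (p i)).prod * ‖∫ x, g (Λ.wordMap w x) ∂μ‖ₑ ^ 2).sum := by
  refine le_trans (by simp [wordMap]) (Λ.le_sum_stopping r _ (fun w => ?_) n)
  have h1 := h.integral_eq hp (hg.comp (Λ.continuous_wordMap w)) (fun x => hC _)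
  simp only [Function.comp_apply] at h1
  rw [h1]
  have hsum : ∑ i, ENNReal.ofReal (p i) = 1 := by
    rw [← ENNReal.ofReal_sum_of_nonneg fun i _ => hp i, hp1, ENNReal.ofReal_one]
  have hj := ENNReal.rpow_arith_mean_le_arith_mean_rpow Finset.univ
    (fun i => ENNReal.ofReal (p i)) (fun i => ‖∫ x, g (Λ.wordMap w (Λ.map i x)) ∂μ‖ₑ) hsum
    (p := 2) (by norm_num)
  simp only [ENNReal.rpow_two] at hj
  calc _ ≤ (w.map fun i => ENNReal.ofReal (p i)).prod *
        (∑ i, ENNReal.ofReal (p i) * ‖∫ x, g (Λ.wordMap w (Λ.map i x)) ∂μ‖ₑ) ^ 2 := by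
        gcongr
        refine (enorm_sum_le _ _).trans (le_of_eq (Finset.sum_congr rfl fun i _ => ?_))
        rw [enorm_mul, ← ofReal_norm, Complex.norm_real, Real.norm_of_nonneg (hp i)]
    _ ≤ _ := by
        refine (mul_le_mul_right hj _).trans (le_of_eq ?_)
        rw [Finset.mul_sum]
        refine Finset.sum_congr rfl fun i _ => ?_
        simp only [List.map_append, List.map_cons, List.map_nil, List.prod_append,
          List.prod_singleton, wordMap_append, mul_assoc]
        rfl

end Stationary

end SelfSimilarIFS

/-! ### Linearizing the phase on cylinders. -/

section Linearization

variable {k : ℕ}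

local notation "𝔼" => EuclideanSpace ℝ (Fin k)

theorem norm_fourierMeasure_neg (μ : Measure 𝔼) (ξ : 𝔼) :
    ‖fourierMeasure μ (-ξ)‖ = ‖fourierMeasure μ ξ‖ := by
  rw [fourierMeasure_eq_charFun, fourierMeasure_eq_charFun, smul_neg, charFun_neg,
    RCLike.norm_conj]

theorem norm_cexp_mul_I_sub_le (a b : ℝ) :
    ‖Complex.exp (a * Complex.I) - Complex.exp (b * Complex.I)‖ ≤ |a - b| := by
  have h1 : Complex.exp (a * Complex.I) - Complex.exp (b * Complex.I)
      = Complex.exp (b * Complex.I) * (Complex.exp (Complex.I * ((a - b : ℝ) : ℂ)) - 1) := by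
    rw [mul_sub, ← Complex.exp_add, mul_one]
    congr 2
    push_cast
    ring
  rw [h1, norm_mul, Complex.norm_exp_ofReal_mul_I, one_mul]
  exact Real.norm_exp_I_mul_ofReal_sub_one_le

/-- Linearizing the phase `ξ f` along a similarity with ratio `ρ` and orthogonal part `O`. -/
theorem norm_integral_cexp_comp_le (μ : Measure 𝔼) [IsProbabilityMeasure μ] {f : 𝔼 → ℝ}
    (hfc : Continuous f) {φ : 𝔼 → 𝔼} (hφ : Continuous φ) {ρ L T : ℝ} (hρ : 0 ≤ ρ)
    {O : 𝔼 ≃ₗᵢ[ℝ] 𝔼} (hφO : ∀ x y, φ y - φ x = ρ • O (y - x)) {K : Set 𝔼}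
    (hKL : ∀ x ∈ K, ‖x‖ ≤ L)
    (hφK : Set.MapsTo φ K K) (hμK : ∀ᵐ y ∂μ, y ∈ K) (hT0 : 0 ≤ T)
    (hT : ∀ x y : 𝔼, ‖x‖ ≤ L → ‖y‖ ≤ L →
      |f y - f x - inner ℝ (gradient f x) (y - x)| ≤ T * ‖y - x‖ ^ 2)
    {ξ : ℝ} (hξ : 0 ≤ ξ) {x : 𝔼} (hx : x ∈ K) :
    ‖∫ y, Complex.exp ((ξ * f (φ y) : ℝ) * Complex.I) ∂μ‖ ≤
      ‖fourierMeasure μ ((ξ * ρ / (2 * Real.pi)) • O.symm (gradient f (φ x)))‖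
        + ξ * (T * (ρ * (2 * L)) ^ 2) := by
  set η : 𝔼 := (ξ * ρ / (2 * Real.pi)) • O.symm (gradient f (φ x)) with hη
  -- The part of the affine phase that does not depend on `y`; it contributes a unimodular factor
  -- only.
  set a : ℝ := ξ * (f (φ x) - ρ * inner ℝ (gradient f (φ x)) (O x)) with ha
  have hpi := Real.pi_pos
  have hphase : ∀ y, ξ * (f (φ x) + inner ℝ (gradient f (φ x)) (φ y - φ x))
      = a + -2 * Real.pi * inner ℝ (-η) y := by
    intro y
    have h1 : inner ℝ (O.symm (gradient f (φ x))) y = inner ℝ (gradient f (φ x)) (O y) := by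
      rw [← O.inner_map_map, LinearIsometryEquiv.apply_symm_apply]
    rw [hφO, inner_smul_right, map_sub, inner_sub_right, hη, inner_neg_left, real_inner_smul_left,
      h1, ha]
    field_simp
    ring
  have hlin : ∫ y, Complex.exp ((ξ * (f (φ x) + inner ℝ (gradient f (φ x)) (φ y - φ x)) : ℝ)
      * Complex.I) ∂μ = Complex.exp (a * Complex.I) * fourierMeasure μ (-η) := by
    rw [fourierMeasure, ← integral_const_mul]
    congr 1; ext y
    rw [hphase, ← Complex.exp_add]
    congr 1
    push_cast
    ring
  have hint : ∀ g : 𝔼 → ℝ, Continuous g →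
      Integrable (fun y => Complex.exp ((g y : ℝ) * Complex.I)) μ := fun g hg =>
    (integrable_const (1 : ℝ)).mono' (Continuous.aestronglyMeasurable (by fun_prop))
      (ae_of_all _ fun y => by rw [Complex.norm_exp_ofReal_mul_I])
  have herr : ‖(∫ y, Complex.exp ((ξ * f (φ y) : ℝ) * Complex.I) ∂μ) -
      ∫ y, Complex.exp ((ξ * (f (φ x) + inner ℝ (gradient f (φ x)) (φ y - φ x)) : ℝ)
      * Complex.I) ∂μ‖ ≤ ξ * (T * (ρ * (2 * L)) ^ 2) := by
    rw [← integral_sub (hint _ (by fun_prop)) (hint _ (by fun_prop))]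
    refine (norm_integral_le_of_norm_le_const (C := ξ * (T * (ρ * (2 * L)) ^ 2)) ?_).trans
      (by simp)
    filter_upwards [hμK] with y hy
    refine (norm_cexp_mul_I_sub_le _ _).trans ?_
    rw [← mul_sub, abs_mul, abs_of_nonneg hξ]
    gcongr
    rw [← sub_sub]
    refine (hT _ _ (hKL _ (hφK hx)) (hKL _ (hφK hy))).trans ?_
    gcongr
    rw [hφO, norm_smul, LinearIsometryEquiv.norm_map, Real.norm_of_nonneg hρ]
    gcongr
    have h1 := norm_sub_le y x
    have h2 := hKL y hy
    have h3 := hKL x hx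
    linarith
  rw [hlin] at herr
  have h1 : ‖Complex.exp (a * Complex.I) * fourierMeasure μ (-η)‖ = ‖fourierMeasure μ η‖ := by
    rw [norm_mul, Complex.norm_exp_ofReal_mul_I, one_mul, norm_fourierMeasure_neg]
  have h2 := norm_le_norm_add_norm_sub' (∫ y, Complex.exp ((ξ * f (φ y) : ℝ) * Complex.I) ∂μ)
    (Complex.exp (a * Complex.I) * fourierMeasure μ (-η))
  rw [h1] at h2
  linarith

theorem enorm_sq_le_two_mul {E F : Type*} [NormedAddCommGroup E] [NormedAddCommGroup F] {z : E}
    {w : F} {e : ℝ} (h : ‖z‖ ≤ ‖w‖ + e) : ‖z‖ₑ ^ 2 ≤ 2 * ‖w‖ₑ ^ 2 + .ofReal (2 * e ^ 2) := by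
  rw [← ofReal_norm, ← ofReal_norm, ← ENNReal.ofReal_pow (norm_nonneg _),
    ← ENNReal.ofReal_pow (norm_nonneg _), ← ENNReal.ofReal_ofNat 2,
    ← ENNReal.ofReal_mul (by norm_num), ← ENNReal.ofReal_add (by positivity) (by positivity)]
  apply ENNReal.ofReal_le_ofReal
  have h0 := norm_nonneg z
  nlinarith [sq_nonneg (‖w‖ - e), norm_nonneg w]

/-- The basic estimate for the image measure at frequency `ξ`, using words stopped at scale `r`. -/
theorem enorm_charFun_map_sq_le {N : ℕ} {Λ : SelfSimilarIFS k N} {p : Fin N → ℝ} {μ : Measure 𝔼}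
    (hst : Λ.IsStationary p μ) (hp : ∀ i, 0 ≤ p i) (hp1 : ∑ i, p i = 1) {f : 𝔼 → ℝ}
    (hf : ContDiff ℝ ∞ f) {K : Set 𝔼} {L T : ℝ} (hKL : ∀ x ∈ K, ‖x‖ ≤ L)
    (hΛK : ∀ i, Set.MapsTo (Λ.map i) K K) (hμK : ∀ᵐ y ∂μ, y ∈ K) (hT0 : 0 ≤ T)
    (hT : ∀ x y : 𝔼, ‖x‖ ≤ L → ‖y‖ ≤ L →
      |f y - f x - inner ℝ (gradient f x) (y - x)| ≤ T * ‖y - x‖ ^ 2)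
    {ξ : ℝ} (hξ : 0 ≤ ξ) {r : ℝ} {n : ℕ}
    (S : Finset (ℝ × (𝔼 ≃ₗᵢ[ℝ] 𝔼))) (hS : ∀ w ∈ Λ.stopping r n,
      Λ.wordRatio w ≤ r ∧ (Λ.wordRatio w, Λ.wordRot w) ∈ S) {D : ℝ≥0∞}
    (hD : ∀ g ∈ S, ∫⁻ x, ‖fourierMeasure μ ((ξ * g.1 / (2 * Real.pi)) •
      g.2.symm (gradient f x))‖ₑ ^ 2 ∂μ ≤ D) :
    ‖charFun (μ.map f) ξ‖ₑ ^ 2 ≤ 2 * (S.card * D)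
      + .ofReal (2 * (ξ * (T * (r * (2 * L)) ^ 2)) ^ 2) := by
  have := hst.1
  set e : ℝ := ξ * (T * (r * (2 * L)) ^ 2) with he
  have hHm : ∀ g : ℝ × (𝔼 ≃ₗᵢ[ℝ] 𝔼), Measurable fun x =>
      ‖fourierMeasure μ ((ξ * g.1 / (2 * Real.pi)) • g.2.symm (gradient f x))‖ₑ ^ 2 := by
    intro g
    have h1 := continuous_gradient hf
    have h2 := g.2.symm.continuous
    have h3 := continuous_fourierMeasure μ
    have h4 : Continuous fun x => fourierMeasure μ
      ((ξ * g.1 / (2 * Real.pi)) • g.2.symm (gradient f x)) := by fun_prop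
    exact h4.measurable.enorm.pow_const 2
  -- `Φ` sums over all linear parts in `S` and so does not depend on the word. This costs the factor
  -- `S.card`, but lets `∑ p_w ∫ Φ ∘ φ_w` be reassembled into `∫ Φ`.
  set Φ : 𝔼 → ℝ≥0∞ := fun x => 2 * ∑ g ∈ S, ‖fourierMeasure μ ((ξ * g.1 / (2 * Real.pi)) •
    g.2.symm (gradient f x))‖ₑ ^ 2 + .ofReal (2 * e ^ 2) with hΦ
  have hΦle : ∀ g ∈ S, ∀ x, 2 * ‖fourierMeasure μ ((ξ * g.1 / (2 * Real.pi)) •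
      g.2.symm (gradient f x))‖ₑ ^ 2 + .ofReal (2 * e ^ 2) ≤ Φ x := by
    intro g hg x
    have h1 := Finset.single_le_sum (f := fun g : ℝ × (𝔼 ≃ₗᵢ[ℝ] 𝔼) =>
      ‖fourierMeasure μ ((ξ * g.1 / (2 * Real.pi)) • g.2.symm (gradient f x))‖ₑ ^ 2)
      (fun _ _ => zero_le) hg
    exact add_le_add_left (mul_le_mul_right h1 2) _
  have hΦm : Measurable Φ :=
    ((Finset.measurable_sum _ fun g _ => hHm g).const_mul _).add_const _
  have hchar : charFun (μ.map f) ξ = ∫ x, Complex.exp ((ξ * f x : ℝ) * Complex.I) ∂μ := by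
    rw [charFun_apply, integral_map hf.continuous.aemeasurable
      (Continuous.aestronglyMeasurable (by fun_prop))]
    simp
  calc ‖charFun (μ.map f) ξ‖ₑ ^ 2
      ≤ ((Λ.stopping r n).map fun w => (w.map fun i => ENNReal.ofReal (p i)).prod *
          ‖∫ x, Complex.exp ((ξ * f (Λ.wordMap w x) : ℝ) * Complex.I) ∂μ‖ₑ ^ 2).sum := by
        rw [hchar]
        have := hf.continuous
        exact hst.enorm_integral_sq_le_sum_stopping hp hp1
          (g := fun x => Complex.exp ((ξ * f x : ℝ) * Complex.I)) (by fun_prop) (C := 1)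
          (fun x => by rw [Complex.norm_exp_ofReal_mul_I]) r n
    _ ≤ ((Λ.stopping r n).map fun w => (w.map fun i => ENNReal.ofReal (p i)).prod *
          ∫⁻ x, Φ (Λ.wordMap w x) ∂μ).sum := by
        refine Multiset.sum_map_le_sum_map _ _ fun w hw => mul_le_mul_right ?_ _
        obtain ⟨hwr, hwS⟩ := hS w hw
        -- The left side does not involve the base point, so it may be averaged over `x` with law
        -- `μ`.
        calc _ = ∫⁻ _, ‖∫ x, Complex.exp ((ξ * f (Λ.wordMap w x) : ℝ) * Complex.I) ∂μ‖ₑ ^ 2 ∂μ := by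
              simp
          _ ≤ _ := by
              refine lintegral_mono_ae ?_
              filter_upwards [hμK] with x hx
              have h1 := norm_integral_cexp_comp_le μ hf.continuous (Λ.continuous_wordMap w)
                (Λ.wordRatio_pos w).le (Λ.wordMap_sub_wordMap w) hKL (Λ.mapsTo_wordMap hΛK w) hμK hT0 hT hξ hx
              have h2 : ξ * (T * (Λ.wordRatio w * (2 * L)) ^ 2) ≤ e := by
                rw [he]
                have := (Λ.wordRatio_pos w).le
                have hL : 0 ≤ L := (norm_nonneg x).trans (hKL x hx)
                gcongr
              have h3 := enorm_sq_le_two_mul (h1.trans (add_le_add_right h2 _))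
              exact h3.trans (hΦle _ hwS _)
    _ ≤ ∫⁻ x, Φ x ∂μ := hst.sum_stopping_lintegral_le hΦm r n
    _ = 2 * ∑ g ∈ S, ∫⁻ x, ‖fourierMeasure μ ((ξ * g.1 / (2 * Real.pi)) •
          g.2.symm (gradient f x))‖ₑ ^ 2 ∂μ + .ofReal (2 * e ^ 2) := by
        rw [hΦ, lintegral_add_right _ measurable_const, lintegral_const_mul' _ _ (by norm_num),
          lintegral_finsetSum _ fun g _ => hHm g]
        simp
    _ ≤ _ := by
        gcongr
        refine (Finset.sum_le_card_nsmul _ _ _ hD).trans (le_of_eq ?_)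
        rw [nsmul_eq_mul]

end Linearization

/-- The modulus is even in `ξ` and at most `1`, so decay on a positive half-line suffices for
comparison with `(1 + |ξ|) ^ (-γ)`. -/
theorem integrable_norm_charFun_sq_of_decay (ν : Measure ℝ) [IsProbabilityMeasure ν]
    {C γ X : ℝ} (hγ : 1 < γ) (hX : 1 ≤ X)
    (h : ∀ ξ : ℝ, X ≤ ξ → ‖charFun ν ξ‖ ^ 2 ≤ C * ξ ^ (-γ)) :
    Integrable fun ξ => ‖charFun ν ξ‖ ^ 2 := by
  have hint : Integrable fun ξ : ℝ => max ((1 + X) ^ γ) (max C 0 * 2 ^ γ) * (1 + ‖ξ‖) ^ (-γ) :=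
    (integrable_one_add_norm (by simpa using hγ)).const_mul _
  refine hint.mono' ?_ (ae_of_all _ fun ξ => ?_)
  · exact Continuous.aestronglyMeasurable (continuous_charFun.norm.pow 2)
  rw [Real.norm_of_nonneg (by positivity), Real.norm_eq_abs]
  have habs : ‖charFun ν ξ‖ = ‖charFun ν |ξ|‖ := by
    rcases abs_cases ξ with ⟨h1, -⟩ | ⟨h1, -⟩ <;> rw [h1]
    rw [charFun_neg, RCLike.norm_conj]
  have h0 : 0 ≤ |ξ| := abs_nonneg ξ
  rcases le_total X |ξ| with hξ | hξ
  · have hξ0 : 0 < |ξ| := by linarith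
    calc ‖charFun ν ξ‖ ^ 2 ≤ C * |ξ| ^ (-γ) := habs ▸ h _ hξ
      _ ≤ max C 0 * (2 ^ γ * (1 + |ξ|) ^ (-γ)) := by
          refine mul_le_mul (le_max_left _ _) ?_ (by positivity) (le_max_right _ _)
          have h2 : 1 + |ξ| ≤ 2 * |ξ| := by linarith
          rw [Real.rpow_neg hξ0.le, Real.rpow_neg (by positivity), ← div_eq_mul_inv,
            le_div_iff₀ (by positivity), inv_mul_le_iff₀ (by positivity),
            mul_comm (|ξ| ^ γ), ← Real.mul_rpow (by norm_num) h0]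
          exact Real.rpow_le_rpow (by positivity) h2 (by linarith)
      _ ≤ _ := by
          rw [← mul_assoc]
          gcongr
          exact le_max_right _ _
  · calc ‖charFun ν ξ‖ ^ 2 ≤ 1 := pow_le_one₀ (norm_nonneg _) (norm_charFun_le_one _)
      _ ≤ (1 + X) ^ γ * (1 + |ξ|) ^ (-γ) := by
          rw [Real.rpow_neg (by positivity), ← div_eq_mul_inv, one_le_div (by positivity)]
          gcongr
      _ ≤ _ := by
          gcongr
          exact le_max_left _ _

/-! ### Fourier decay of the image measure. -/

section Main

variable {k : ℕ}

local notation "𝔼" => EuclideanSpace ℝ (Fin k)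

theorem SelfSimilarIFS.IsAttractor.mapsTo {N : ℕ} {Λ : SelfSimilarIFS k N} {K : Set 𝔼}
    (h : Λ.IsAttractor K) (i : Fin N) : Set.MapsTo (Λ.map i) K K := fun x hx => by
  rw [h.2.2]
  exact Set.mem_iUnion.2 ⟨i, x, hx, rfl⟩

/-- The energy bound contributes `R ^ (k - s)`, the mass bound for the image under `∇f` contributes
`R ^ (-d)`, and `s ≤ d`. AD-regularity supplies a pointwise ball bound where energy alone gives only
an average one. -/
theorem exists_lintegral_gradient_decay {f : 𝔼 → ℝ} (hf : ContDiff ℝ ∞ f)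
    (hH : ∀ x, (hessianMatrix f x).det ≠ 0) (μ : Measure 𝔼) [IsProbabilityMeasure μ]
    (hAD : IsADRegular μ) {K : Set 𝔼} (hK : IsCompact K) (hμK : μ Kᶜ = 0) {s B : ℝ}
    (hμ : ∀ R : ℝ, 0 < R → ∫⁻ ξ in Metric.ball 0 R, ‖fourierMeasure μ ξ‖ₑ ^ 2
        ≤ .ofReal B * .ofReal (R ^ ((k : ℝ) - s))) :
    ∃ C : ℝ, 0 ≤ C ∧ ∀ R : ℝ, 1 ≤ R → ∀ O : 𝔼 ≃ₗᵢ[ℝ] 𝔼,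
      ∫⁻ x, ‖fourierMeasure μ (R • O (gradient f x))‖ₑ ^ 2 ∂μ
        ≤ .ofReal (C * R ^ ((k : ℝ) - 2 * s)) := by
  obtain ⟨d, A, hd0, hA1, hd⟩ := hAD
  have hsd : s ≤ d := energy_exponent_le_of_ball_lower_bound μ (C := A⁻¹) (by positivity)
    (fun x hx r hr hr1 => (hd x hx r hr hr1).1) hμ
  have hsub : μ.support ⊆ K := Measure.support_subset_of_isClosed hK.isClosed
    (by rw [mem_ae_iff]; exact hμK)
  have hGc := continuous_gradient hf
  obtain ⟨L₁, hL₁⟩ := hK.exists_bound_of_continuousOn continuousOn_id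
  obtain ⟨L₂, hL₂⟩ := hK.exists_bound_of_continuousOn hGc.continuousOn
  have hae : ∀ᵐ x ∂μ, x ∈ K := by rw [ae_iff]; exact hμK
  obtain ⟨A', hA'⟩ := exists_map_gradient_ball_le hf hH μ
    (hK.of_isClosed_subset Measure.isClosed_support hsub) (s := d) (A := A) fun x hx r hr =>
      measure_ball_le_of_le_one μ hd0 hA1 (fun r hr hr1 => (hd x hx r hr hr1).2) hr
  have : IsProbabilityMeasure (μ.map (gradient f)) :=
    Measure.isProbabilityMeasure_map hGc.aemeasurable
  obtain ⟨C, hC⟩ := lintegral_enorm_fourierMeasure_sq_le μ (μ.map (gradient f)) (L := max L₁ L₂)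
    (hae.mono fun x hx => (hL₁ x hx).trans (le_max_left _ _))
    ((ae_map_iff hGc.aemeasurable (isClosed_le continuous_norm continuous_const).measurableSet).2
      (hae.mono fun x hx => (hL₂ x hx).trans (le_max_right _ _))) hA' hμ
  refine ⟨max C 0, le_max_right _ _, fun R hR O => ?_⟩
  have hm : Measurable fun z => ‖fourierMeasure μ (R • O z)‖ₑ ^ 2 := by
    have h2 := O.continuous
    have h3 := continuous_fourierMeasure μ
    have h4 : Continuous fun z => fourierMeasure μ (R • O z) := by fun_prop
    exact h4.measurable.enorm.pow_const 2
  have h1 := hC R hR O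
  rw [lintegral_map hm hGc.measurable] at h1
  refine h1.trans ?_
  rw [ENNReal.ofReal_mul (le_max_right _ _)]
  refine mul_le_mul' (ENNReal.ofReal_le_ofReal (le_max_left _ _)) (ENNReal.ofReal_le_ofReal ?_)
  exact Real.rpow_le_rpow_of_exponent_le hR (by linarith)

/-- Power decay of the Fourier transform of the image measure, with exponent larger than one. -/
theorem exists_charFun_map_decay {f : 𝔼 → ℝ} (hf : ContDiff ℝ ∞ f)
    (hH : ∀ x, (hessianMatrix f x).det ≠ 0) {μ : Measure 𝔼} (hAD : IsADRegular μ)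
    (hμ : IsNonExpandingSelfSimilarMeasure μ) (hκ : 2 + (k : ℝ) / 2 < kappaTwo μ) :
    ∃ C γ X : ℝ, 1 < γ ∧ 1 ≤ X ∧ ∀ ξ : ℝ, X ≤ ξ → ‖charFun (μ.map f) ξ‖ ^ 2 ≤ C * ξ ^ (-γ) := by
  obtain ⟨N, Λ, p, hΛ, hp, hp1, hst⟩ := hμ
  have := hst.1
  obtain ⟨K, hK, hμK⟩ := hst.2.1
  obtain ⟨s, B, hs, -, -, hsB⟩ := exists_exponent_of_lt_kappaTwo μ (by positivity) hκ
  obtain ⟨C₂, hC₂0, hC₂⟩ := exists_lintegral_gradient_decay hf hH μ hAD hK.2.1 hμK hsB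
  obtain ⟨L, hL⟩ := hK.2.1.exists_bound_of_continuousOn continuousOn_id
  obtain ⟨T, hT0, hT⟩ := exists_taylor_bound hf L
  obtain ⟨a, b, ha0, ha1, hb0, hb1, hab⟩ := Λ.exists_ratio_bounds
  have hae : ∀ᵐ x ∂μ, x ∈ K := by rw [ae_iff]; exact hμK
  have hpi := Real.pi_pos
  obtain ⟨d, hd0, hsd⟩ : ∃ d : ℝ, 0 < d ∧ s = 2 + (k : ℝ) / 2 + d :=
    ⟨s - (2 + (k : ℝ) / 2), by linarith, by ring⟩
  -- `s = 2 + k/2 + d` gives `k - 2s = -(4 + 2d)`; at `R = ξ ^ (1/4 - t)` this choice makes the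
  -- exponent `-(1 + d/2 - d/4) = -(1 + d/4)`.
  obtain ⟨t, ht0, ht1⟩ : ∃ t : ℝ, 0 < t ∧ t * (4 + 2 * d) = d / 4 :=
    ⟨d / 4 / (4 + 2 * d), by positivity, by field_simp⟩
  have ht4 : t < 1 / 4 := by nlinarith
  set lam := -Real.log b with hlam
  have hlam0 : 0 < lam := by
    have := Real.log_neg hb0 hb1
    linarith
  -- With `r = ξ ^ (-q)`, frequencies scale as `ξ r = ξ ^ (1/4 - t)` and the squared error as `ξ² r⁴
  -- = ξ ^ (-(1 + 4t))`.
  set q := 3 / 4 + t with hq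
  have hq0 : 0 < q := by positivity
  -- About `q log ξ / lam` rounds reach ratio `r`, so the number of linear parts is `O(ξ ^ (d/8))`,
  -- half of the surplus `d/4`.
  set ε := d / 8 * lam / q with hε
  have hε0 : 0 < ε := by positivity
  obtain ⟨C₁, hC₁0, hC₁⟩ := hΛ.exists_finset_linear_parts hε0
  set c₀ := a / (2 * Real.pi) with hc₀
  have hc₀0 : 0 < c₀ := by positivity
  obtain ⟨X, hX⟩ : ∃ X : ℝ, ∀ ξ, X ≤ ξ → 1 ≤ c₀ * ξ ^ (1 / 4 - t) := by
    have h1 : Tendsto (fun ξ : ℝ => c₀ * ξ ^ (1 / 4 - t)) atTop atTop :=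
      (tendsto_rpow_atTop (by linarith)).const_mul_atTop hc₀0
    exact eventually_atTop.1 (h1.eventually_ge_atTop 1)
  set M := 2 * (C₁ * Real.exp ε * (C₂ * c₀ ^ ((k : ℝ) - 2 * s))) + 2 * (T * (2 * L) ^ 2) ^ 2 with hM
  refine ⟨M, 1 + min (d / 8) (4 * t), max X 1, by
    have : 0 < min (d / 8) (4 * t) := by positivity
    linarith, le_max_right _ _, fun ξ hξ => ?_⟩
  have hξ1 : 1 ≤ ξ := (le_max_right _ _).trans hξ
  have hξ0 : 0 < ξ := by linarith
  have hR1 := hX ξ ((le_max_left _ _).trans hξ)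
  set r := ξ ^ (-q) with hr
  have hr0 : 0 < r := by positivity
  have hr1 : r ≤ 1 := Real.rpow_le_one_of_one_le_of_nonpos hξ1 (by linarith)
  have hlog : 0 ≤ Real.log ξ := Real.log_nonneg hξ1
  set n := ⌈q * Real.log ξ / lam⌉₊ with hn
  have hbn : b ^ n ≤ r := by
    rw [hr, Real.rpow_def_of_pos hξ0, ← Real.exp_log hb0, ← Real.exp_nat_mul, Real.exp_le_exp]
    have h1 : q * Real.log ξ / lam ≤ n := Nat.le_ceil _
    rw [div_le_iff₀ hlam0] at h1
    have h2 : Real.log b = -lam := by rw [hlam, neg_neg]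
    rw [h2]
    linarith
  obtain ⟨S₀, hS₀, hS₀c⟩ := hC₁ n
  classical
  -- Discarding smaller ratios keeps every frequency above `c₀ * ξ ^ (1/4 - t) ≥ 1`; as the decay
  -- exponent is negative, this lower bound is the worst case.
  set S := S₀.filter fun g => a * r ≤ g.1 with hS
  have hScard : (S.card : ℝ) ≤ C₁ * Real.exp ε * ξ ^ (d / 8) := by
    calc (S.card : ℝ) ≤ S₀.card := by exact_mod_cast Finset.card_filter_le _ _
      _ ≤ C₁ * Real.exp (ε * n) := hS₀c
      _ ≤ C₁ * Real.exp (ε + Real.log ξ * (d / 8)) := by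
          gcongr
          have h1 : (n : ℝ) ≤ q * Real.log ξ / lam + 1 :=
            (Nat.ceil_lt_add_one (by positivity)).le
          calc ε * n ≤ ε * (q * Real.log ξ / lam + 1) := by gcongr
            _ = _ := by rw [hε]; field_simp; ring
      _ = _ := by rw [Real.exp_add, Real.rpow_def_of_pos hξ0]; ring
  have hmain := enorm_charFun_map_sq_le hst (fun i => (hp i).1.le) hp1 hf hL hK.mapsTo hae hT0 hT
    hξ0.le (r := r) (n := n) S (fun w hw => by
      have h1 := Λ.wordRatio_le_of_mem_stopping hr1 (fun i => (hab i).1) ha0 ha1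
        (fun i => (hab i).2) hbn hw
      obtain ⟨h2, h3, -⟩ := Λ.mem_stopping hr1 (fun i => (hab i).1) ha0 ha1 w hw
      exact ⟨h1, Finset.mem_filter.2 ⟨hS₀ w h2, h3⟩⟩)
    (D := .ofReal (C₂ * (c₀ * ξ ^ (1 / 4 - t)) ^ ((k : ℝ) - 2 * s))) (fun g hg => by
      have hg1 : a * r ≤ g.1 := (Finset.mem_filter.1 hg).2
      have hR : c₀ * ξ ^ (1 / 4 - t) ≤ ξ * g.1 / (2 * Real.pi) := by
        have h1 : ξ ^ (1 / 4 - t) = ξ * r := by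
          rw [hr, ← Real.rpow_one_add' hξ0.le (by rw [hq]; linarith)]
          congr 1; rw [hq]; ring
        rw [h1, hc₀, div_mul_eq_mul_div]
        refine div_le_div_of_nonneg_right ?_ (by positivity)
        nlinarith
      refine (hC₂ _ (hR1.trans hR) g.2.symm).trans (ENNReal.ofReal_le_ofReal ?_)
      refine mul_le_mul_of_nonneg_left ?_ hC₂0
      exact Real.rpow_le_rpow_of_nonpos (by positivity) hR (by rw [hsd]; linarith))
  have hreal : ‖charFun (μ.map f) ξ‖ ^ 2 ≤ 2 * (S.card *
      (C₂ * (c₀ * ξ ^ (1 / 4 - t)) ^ ((k : ℝ) - 2 * s)))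
      + 2 * (ξ * (T * (r * (2 * L)) ^ 2)) ^ 2 := by
    rw [← ENNReal.ofReal_le_ofReal_iff (by positivity), ← enorm_sq_eq_ofReal,
      ENNReal.ofReal_add (by positivity) (by positivity), ENNReal.ofReal_mul (by norm_num),
      ENNReal.ofReal_mul (by positivity), ENNReal.ofReal_natCast]
    simpa using hmain
  have e1 : (c₀ * ξ ^ (1 / 4 - t)) ^ ((k : ℝ) - 2 * s)
      = c₀ ^ ((k : ℝ) - 2 * s) * ξ ^ (-(1 + d / 4)) := by
    rw [Real.mul_rpow hc₀0.le (by positivity), ← Real.rpow_mul hξ0.le]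
    congr 2
    rw [hsd]
    linarith
  have e2 : (ξ * (T * (r * (2 * L)) ^ 2)) ^ 2 = (T * (2 * L) ^ 2) ^ 2 * ξ ^ (-(1 + 4 * t)) := by
    have h1 : ξ ^ (-(1 + 4 * t)) = ξ ^ 2 * r ^ 4 := by
      rw [hr, ← Real.rpow_natCast (ξ ^ (-q)) 4, ← Real.rpow_mul hξ0.le, ← Real.rpow_natCast ξ 2,
        ← Real.rpow_add hξ0]
      congr 1
      rw [hq]
      push_cast
      ring
    rw [h1]
    ring
  have hmin1 : min (d / 8) (4 * t) ≤ d / 8 := min_le_left _ _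
  have hmin2 : min (d / 8) (4 * t) ≤ 4 * t := min_le_right _ _
  set γ := 1 + min (d / 8) (4 * t)
  have p1 : ξ ^ (d / 8) * ξ ^ (-(1 + d / 4)) ≤ ξ ^ (-γ) := by
    rw [← Real.rpow_add hξ0]
    exact Real.rpow_le_rpow_of_exponent_le hξ1 (by simp only [γ]; linarith)
  have p2 : ξ ^ (-(1 + 4 * t)) ≤ ξ ^ (-γ) :=
    Real.rpow_le_rpow_of_exponent_le hξ1 (by simp only [γ]; linarith)
  rw [e1, e2] at hreal
  calc _ ≤ _ := hreal
    _ ≤ 2 * (C₁ * Real.exp ε * ξ ^ (d / 8) * (C₂ * (c₀ ^ ((k : ℝ) - 2 * s) * ξ ^ (-(1 + d / 4)))))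
        + 2 * ((T * (2 * L) ^ 2) ^ 2 * ξ ^ (-(1 + 4 * t))) := by gcongr
    _ = 2 * (C₁ * Real.exp ε * (C₂ * c₀ ^ ((k : ℝ) - 2 * s))) * (ξ ^ (d / 8) * ξ ^ (-(1 + d / 4)))
        + 2 * (T * (2 * L) ^ 2) ^ 2 * ξ ^ (-(1 + 4 * t)) := by ring
    _ ≤ 2 * (C₁ * Real.exp ε * (C₂ * c₀ ^ ((k : ℝ) - 2 * s))) * ξ ^ (-γ)
        + 2 * (T * (2 * L) ^ 2) ^ 2 * ξ ^ (-γ) := by gcongr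
    _ = _ := by rw [hM]; ring

theorem hasL2Density_map_of_kappaTwo {f : 𝔼 → ℝ} (hf : ContDiff ℝ ∞ f)
    (hH : ∀ x, (hessianMatrix f x).det ≠ 0) {μ : Measure 𝔼} (hAD : IsADRegular μ)
    (hμ : IsNonExpandingSelfSimilarMeasure μ) (hκ : 2 + (k : ℝ) / 2 < kappaTwo μ) :
    HasL2Density (μ.map f) := by
  obtain ⟨C, γ, X, hγ, hX, h⟩ := exists_charFun_map_decay hf hH hAD hμ hκ
  obtain ⟨N, Λ, p, -, -, -, hst⟩ := hμ
  have := hst.1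
  have : IsProbabilityMeasure (μ.map f) :=
    Measure.isProbabilityMeasure_map hf.continuous.aemeasurable
  exact hasL2Density_of_integrable_charFun _ (integrable_norm_charFun_sq_of_decay _ hγ hX h)

end Main

/-! ### Coding and existence of self-similar measures. -/

/-- Prepending a letter to an infinite word. -/
def consSeq {α : Type*} (i : α) (u : ℕ → α) : ℕ → α
  | 0 => i
  | n + 1 => u n

/-- The product measure on infinite words is invariant under prepending a random letter. -/
theorem sum_smul_map_consSeq_infinitePi {N : ℕ} (P : Fin N → ℝ≥0∞) (ν : Measure (Fin N))
    [IsProbabilityMeasure ν] (hν : ν = ∑ i, P i • Measure.dirac i) :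
    ∑ i, P i • (Measure.infinitePi fun _ : ℕ => ν).map (consSeq i)
      = Measure.infinitePi fun _ : ℕ => ν := by
  have hcons : ∀ i : Fin N, Measurable (consSeq i) := by
    intro i
    refine measurable_pi_lambda _ fun n => ?_
    cases n with
    | zero => exact measurable_const
    | succ n => exact measurable_pi_apply n
  refine Measure.eq_infinitePi (fun _ => ν) fun s t ht => ?_
  classical
  obtain ⟨n, hn⟩ : ∃ n, s ⊆ Finset.range (n + 1) := by
    obtain ⟨n, hn⟩ := s.exists_nat_subset_range
    exact ⟨n, hn.trans (Finset.range_subset_range.2 (Nat.le_succ n))⟩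
  -- Padding with `univ` turns the box into one over an initial segment, where prepending a letter
  -- fixes coordinate `0` and shifts the rest.
  set t' : ℕ → Set (Fin N) := fun i => if i ∈ s then t i else Set.univ with ht'
  have ht'm : ∀ i, MeasurableSet (t' i) := fun i => (Set.toFinite _).measurableSet
  have hset : (s : Set ℕ).pi t = ((Finset.range (n + 1) : Finset ℕ) : Set ℕ).pi t' := by
    ext u
    simp only [Set.mem_pi, Finset.mem_coe, ht']
    refine ⟨fun h i _ => ?_, fun h i hi => ?_⟩
    · split_ifs with his
      · exact h i his
      · trivial
    · simpa [hi] using h i (hn hi)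
  have hprod : ∏ i ∈ s, ν (t i) = ∏ i ∈ Finset.range (n + 1), ν (t' i) := by
    rw [← Finset.prod_subset hn fun i _ hi => by simp [ht', hi]]
    exact Finset.prod_congr rfl fun i hi => by simp [ht', hi]
  have hpre : ∀ i : Fin N, consSeq i ⁻¹' ((Finset.range (n + 1) : Finset ℕ) : Set ℕ).pi t'
      = if i ∈ t' 0 then ((Finset.range n : Finset ℕ) : Set ℕ).pi (fun j => t' (j + 1)) else ∅ := by
    intro i
    ext u
    split_ifs with hi
    · simp only [Set.mem_preimage, Set.mem_pi, Finset.mem_coe, Finset.mem_range]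
      refine ⟨fun h j hj => h (j + 1) (by omega), fun h j hj => ?_⟩
      cases j with
      | zero => exact hi
      | succ j => exact h j (by omega)
    · simp only [Set.mem_preimage, Set.mem_pi, Finset.mem_coe, Finset.mem_range, Set.mem_empty_iff_false,
        iff_false]
      exact fun h => hi (h 0 (by omega))
  have hboxm : MeasurableSet (((Finset.range (n + 1) : Finset ℕ) : Set ℕ).pi t') :=
    MeasurableSet.pi (Finset.countable_toSet _) fun i _ => ht'm i
  rw [hset, hprod, Finset.prod_range_succ', Measure.coe_finsetSum, Finset.sum_apply]
  have hterm : ∀ i : Fin N, (P i • (Measure.infinitePi fun _ : ℕ => ν).map (consSeq i))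
      (((Finset.range (n + 1) : Finset ℕ) : Set ℕ).pi t')
      = (∏ j ∈ Finset.range n, ν (t' (j + 1))) * (P i • Measure.dirac i) (t' 0) := by
    intro i
    rw [Measure.smul_apply, Measure.map_apply (hcons i) hboxm, hpre, Measure.smul_apply,
      Measure.dirac_apply' _ (ht'm 0)]
    split_ifs with hi
    · rw [Measure.infinitePi_pi _ fun j _ => ht'm (j + 1)]
      simp [hi, mul_comm]
    · simp [hi]
  simp_rw [hterm]
  rw [← Finset.mul_sum]
  congr 1
  conv_rhs => rw [hν]
  rw [Measure.coe_finsetSum, Finset.sum_apply]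

namespace SelfSimilarIFS

variable {k N : ℕ} (Λ : SelfSimilarIFS k N)

theorem dist_map (i : Fin N) (x y : EuclideanSpace ℝ (Fin k)) : dist (Λ.map i x) (Λ.map i y) = Λ.ratio i * dist x y := by
  rw [dist_eq_norm, map_sub_map, norm_smul, Real.norm_of_nonneg (Λ.ratio_pos i).le,
    LinearIsometryEquiv.norm_map, ← dist_eq_norm]

theorem dist_wordMap (w : List (Fin N)) (x y : EuclideanSpace ℝ (Fin k)) :
    dist (Λ.wordMap w x) (Λ.wordMap w y) = Λ.wordRatio w * dist x y := by
  rw [dist_eq_norm, wordMap_sub_wordMap, norm_smul, Real.norm_of_nonneg (Λ.wordRatio_pos w).le,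
    LinearIsometryEquiv.norm_map, ← dist_eq_norm]

/-- The coding map of the system. -/
theorem exists_coding {E : Set (EuclideanSpace ℝ (Fin k))} (hE : IsClosed E) (hne : E.Nonempty)
    (hΛE : ∀ i, Set.MapsTo (Λ.map i) E E) :
    ∃ π : (ℕ → Fin N) → EuclideanSpace ℝ (Fin k), Continuous π ∧ (∀ u, π u ∈ E) ∧
      ∀ i u, π (consSeq i u) = Λ.map i (π u) := by
  obtain ⟨x₀, hx₀⟩ := hne
  obtain ⟨a, b, -, -, hb0, hb1, hab⟩ := Λ.exists_ratio_bounds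
  have hcont : ∀ g : C(ℕ → Fin N, EuclideanSpace ℝ (Fin k)),
      Continuous fun u : ℕ → Fin N => Λ.map (u 0) (g fun n => u (n + 1)) := by
    intro g
    have h1 : Continuous fun q : Fin N × EuclideanSpace ℝ (Fin k) => Λ.map q.1 q.2 :=
      continuous_prod_of_discrete_left.2 fun i => Λ.continuous_map i
    have h2 : Continuous fun u : ℕ → Fin N => (u 0, g fun n => u (n + 1)) := by fun_prop
    exact h1.comp h2
  -- The coding map is the fixed point of `F`, a contraction by `b` on continuous functions of the
  -- infinite word; iterating from a constant in `E` keeps all values in `E`.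
  let F : C(ℕ → Fin N, EuclideanSpace ℝ (Fin k)) → C(ℕ → Fin N, EuclideanSpace ℝ (Fin k)) := fun g => ⟨_, hcont g⟩
  have hF : ContractingWith ⟨b, hb0.le⟩ F := by
    refine ⟨by exact_mod_cast hb1, LipschitzWith.of_dist_le_mul fun g h => ?_⟩
    rw [ContinuousMap.dist_le (by positivity)]
    intro u
    change dist (Λ.map (u 0) _) (Λ.map (u 0) _) ≤ b * dist g h
    rw [dist_map]
    exact mul_le_mul (hab _).2 (ContinuousMap.dist_apply_le_dist _) dist_nonneg hb0.le
  obtain ⟨g, hg, hlim, -⟩ := hF.exists_fixedPoint (ContinuousMap.const _ x₀) (edist_ne_top _ _)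
  have hiter : ∀ n u, (F^[n] (ContinuousMap.const _ x₀)) u ∈ E := by
    intro n
    induction n with
    | zero => exact fun u => hx₀
    | succ n ih =>
      intro u
      rw [Function.iterate_succ_apply']
      exact hΛE _ (ih _)
  refine ⟨g, g.continuous, fun u => ?_, fun i u => ?_⟩
  · exact hE.mem_of_tendsto (((continuous_eval_const (F := C(ℕ → Fin N, EuclideanSpace ℝ (Fin k))) u).tendsto g).comp hlim)
      (.of_forall fun n => hiter n u)
  · conv_lhs => rw [← hg]
    rfl

/-- Existence of the self-similar measure. -/
theorem exists_isStationary {E : Set (EuclideanSpace ℝ (Fin k))} (hE : IsClosed E) (hne : E.Nonempty)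
    (hΛE : ∀ i, Set.MapsTo (Λ.map i) E E) {p : Fin N → ℝ} (hp : ∀ i, 0 ≤ p i)
    (hp1 : ∑ i, p i = 1) :
    ∃ (K : Set (EuclideanSpace ℝ (Fin k))) (μ : Measure (EuclideanSpace ℝ (Fin k))), K ⊆ E ∧ Λ.IsAttractor K ∧ μ Kᶜ = 0 ∧ Λ.IsStationary p μ := by
  obtain ⟨π, hπ, hπE, hπc⟩ := Λ.exists_coding hE hne hΛE
  have : Nonempty (Fin N) := ⟨⟨0, by linarith [Λ.one_lt]⟩⟩
  set ν : Measure (Fin N) := ∑ i, ENNReal.ofReal (p i) • Measure.dirac i with hν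
  have hνp : IsProbabilityMeasure ν := ⟨by
    rw [hν, Measure.coe_finsetSum, Finset.sum_apply]
    simp only [Measure.smul_apply, measure_univ, smul_eq_mul, mul_one]
    rw [← ENNReal.ofReal_sum_of_nonneg fun i _ => hp i, hp1, ENNReal.ofReal_one]⟩
  -- The measure sought is the image of this Bernoulli measure under `π`: since `π` intertwines
  -- `consSeq i` with `Λ.map i`, invariance under prepending becomes stationarity.
  set P := Measure.infinitePi fun _ : ℕ => ν with hP
  have hcons : ∀ i : Fin N, Measurable (consSeq i) := by
    intro i
    refine measurable_pi_lambda _ fun n => ?_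
    cases n with
    | zero => exact measurable_const
    | succ n => exact measurable_pi_apply n
  have hshift : ∀ u : ℕ → Fin N, consSeq (u 0) (fun n => u (n + 1)) = u := by
    intro u
    funext n
    cases n <;> rfl
  have hK : Λ.IsAttractor (Set.range π) := by
    refine ⟨Set.range_nonempty π, isCompact_range hπ, ?_⟩
    ext x
    constructor
    · rintro ⟨u, rfl⟩
      refine Set.mem_iUnion.2 ⟨u 0, π fun n => u (n + 1), ⟨_, rfl⟩, ?_⟩
      rw [← hπc, hshift]
    · intro hx
      obtain ⟨i, -, ⟨u, rfl⟩, rfl⟩ := Set.mem_iUnion.1 hx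
      exact ⟨consSeq i u, hπc i u⟩
  have hμK : P.map π (Set.range π)ᶜ = 0 := by
    rw [Measure.map_apply hπ.measurable hK.2.1.isClosed.measurableSet.compl]
    convert measure_empty (μ := P)
    ext u
    simp
  refine ⟨Set.range π, P.map π, Set.range_subset_iff.2 hπE, hK, hμK,
    Measure.isProbabilityMeasure_map hπ.aemeasurable, ⟨_, hK, hμK⟩, ?_⟩
  have hinv := sum_smul_map_consSeq_infinitePi (fun i => ENNReal.ofReal (p i)) ν hν
  rw [← hP] at hinv
  ext A hA
  rw [Measure.map_apply hπ.measurable hA]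
  conv_lhs => rw [← hinv]
  rw [Measure.coe_finsetSum, Finset.sum_apply, Measure.coe_finsetSum, Finset.sum_apply]
  refine Finset.sum_congr rfl fun i _ => ?_
  rw [Measure.smul_apply, Measure.smul_apply, Measure.map_apply (hcons i) (hπ.measurable hA),
    Measure.map_apply (Λ.continuous_map i).measurable hA,
    Measure.map_apply hπ.measurable ((Λ.continuous_map i).measurable hA)]
  congr 2
  ext u
  simp [hπc]

end SelfSimilarIFS

/-! ### Natural measures of separated systems. -/

namespace SelfSimilarIFS

section Separated

variable {k N : ℕ} {Λ : SelfSimilarIFS k N} {t : ℝ} {μ : Measure (EuclideanSpace ℝ (Fin k))} {K : Set (EuclideanSpace ℝ (Fin k))}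

theorem IsStationary.measure_eq {p : Fin N → ℝ} (h : Λ.IsStationary p μ) {A : Set (EuclideanSpace ℝ (Fin k))}
    (hA : MeasurableSet A) : μ A = ∑ i, ENNReal.ofReal (p i) * μ (Λ.map i ⁻¹' A) := by
  have h1 := h.lintegral_eq (g := A.indicator 1) (measurable_one.indicator hA)
  rw [lintegral_indicator_one hA] at h1
  rw [h1]
  refine Finset.sum_congr rfl fun i _ => ?_
  rw [← lintegral_indicator_one ((Λ.continuous_map i).measurable hA)]
  rfl

theorem preimage_map_ball (i : Fin N) (x : EuclideanSpace ℝ (Fin k)) (ρ : ℝ) :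
    Λ.map i ⁻¹' Metric.ball (Λ.map i x) ρ = Metric.ball x (ρ / Λ.ratio i) := by
  ext y
  rw [Set.mem_preimage, Metric.mem_ball, Metric.mem_ball, dist_map, lt_div_iff₀' (Λ.ratio_pos i)]

theorem exists_gap (hK : IsCompact K)
    (hsep : Pairwise fun i j => Disjoint (Λ.map i '' K) (Λ.map j '' K)) :
    ∃ δ : ℝ, 0 < δ ∧ ∀ i j, i ≠ j → ∀ x ∈ K, ∀ y ∈ K, δ ≤ dist (Λ.map i x) (Λ.map j y) := by
  have hgap : ∀ q : Fin N × Fin N, ∃ δ : ℝ, 0 < δ ∧ (q.1 ≠ q.2 → ∀ x ∈ K, ∀ y ∈ K,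
      δ ≤ dist (Λ.map q.1 x) (Λ.map q.2 y)) := by
    rintro ⟨i, j⟩
    by_cases hij : i = j
    · exact ⟨1, one_pos, fun h => absurd hij h⟩
    · obtain ⟨r, hr0, hr⟩ := Metric.exists_pos_forall_lt_edist (hK.image (Λ.continuous_map i))
        (hK.image (Λ.continuous_map j)).isClosed (hsep hij)
      refine ⟨r, hr0, fun _ x hx y hy => ?_⟩
      have := hr _ ⟨x, hx, rfl⟩ _ ⟨y, hy, rfl⟩
      rw [edist_nndist, ENNReal.coe_lt_coe] at this
      exact_mod_cast this.le
  choose δ hδ0 hδ using hgap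
  have : Nonempty (Fin N) := ⟨⟨0, by linarith [Λ.one_lt]⟩⟩
  obtain ⟨q, hq⟩ := Finite.exists_min δ
  exact ⟨δ q, hδ0 q, fun i j hij x hx y hy => (hq (i, j)).trans (hδ (i, j) hij x hx y hy)⟩

/-- Upper mass bound for separated systems with natural weights. -/
theorem IsStationary.measure_ball_le (h : Λ.IsStationary (fun i => Λ.ratio i ^ t) μ) (ht : 0 ≤ t)
    (hK : Λ.IsAttractor K) (hμK : μ Kᶜ = 0) {δ : ℝ} (hδ0 : 0 < δ)
    (hδ : ∀ i j, i ≠ j → ∀ x ∈ K, ∀ y ∈ K, δ ≤ dist (Λ.map i x) (Λ.map j y))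
    {x : EuclideanSpace ℝ (Fin k)} (hx : x ∈ K) {ρ : ℝ} (hρ : 0 < ρ) : μ (Metric.ball x ρ) ≤ ENNReal.ofReal ((ρ / δ) ^ t) := by
  have := h.1
  obtain ⟨a, b, -, -, hb0, hb1, hab⟩ := Λ.exists_ratio_bounds
  -- A ball of radius below the gap `δ`, centred in one first-level piece, misses the others;
  -- zooming in by `Λ.ratio i` then scales mass and bound alike. `n` bounds the number of zooms
  -- before the radius exceeds `δ`.
  have key : ∀ n : ℕ, ∀ x ∈ K, ∀ ρ : ℝ, 0 < ρ → δ * b ^ n ≤ ρ →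
      μ (Metric.ball x ρ) ≤ ENNReal.ofReal ((ρ / δ) ^ t) := by
    have hbig : ∀ x : EuclideanSpace ℝ (Fin k), ∀ ρ : ℝ, δ ≤ ρ → μ (Metric.ball x ρ) ≤ ENNReal.ofReal ((ρ / δ) ^ t) := by
      intro x ρ hρ
      refine prob_le_one.trans (ENNReal.one_le_ofReal.2 (Real.one_le_rpow ?_ ht))
      rwa [one_le_div hδ0]
    intro n
    induction n with
    | zero => exact fun x _ ρ _ h => hbig x ρ (by simpa using h)
    | succ n ih =>
      intro x hx ρ hρ hn
      rcases le_or_gt δ ρ with h1 | h1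
      · exact hbig x ρ h1
      rw [hK.2.2] at hx
      obtain ⟨i, x', hx', rfl⟩ := Set.mem_iUnion.1 hx
      have hri := Λ.ratio_pos i
      rw [h.measure_eq measurableSet_ball, Finset.sum_eq_single i]
      · rw [preimage_map_ball]
        refine (mul_le_mul_right (ih x' hx' (ρ / Λ.ratio i) (by positivity) ?_) _).trans ?_
        · rw [le_div_iff₀ hri]
          calc δ * b ^ n * Λ.ratio i ≤ δ * b ^ n * b := by
                gcongr
                exact (hab i).2
            _ = δ * b ^ (n + 1) := by ring
            _ ≤ ρ := hn
        · rw [← ENNReal.ofReal_mul (by positivity), ← Real.mul_rpow hri.le (by positivity)]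
          apply le_of_eq
          congr 2
          field_simp
      · intro j _ hji
        refine mul_eq_zero_of_right _ (measure_mono_null (fun y hy => ?_) hμK)
        intro hyK
        have h2 := hδ j i hji y hyK x' hx'
        have h3 : dist (Λ.map j y) (Λ.map i x') < ρ := hy
        linarith
      · simp
  obtain ⟨n, hn⟩ := exists_pow_lt_of_lt_one (show 0 < ρ / δ by positivity) hb1
  refine key n x hx ρ hρ ?_
  rw [lt_div_iff₀' hδ0] at hn
  exact hn.le

/-- Lower mass bound for systems with natural weights. -/
theorem IsStationary.le_measure_ball (h : Λ.IsStationary (fun i => Λ.ratio i ^ t) μ) (ht : 0 ≤ t)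
    (hK : Λ.IsAttractor K) (hμK : μ Kᶜ = 0) :
    ∃ c : ℝ, 0 < c ∧ ∀ x ∈ K, ∀ ρ : ℝ, 0 < ρ → ρ ≤ 1 →
      ENNReal.ofReal (c * ρ ^ t) ≤ μ (Metric.ball x ρ) := by
  have := h.1
  obtain ⟨a, b, ha0, ha1, hb0, hb1, hab⟩ := Λ.exists_ratio_bounds
  obtain ⟨D, hD0, hD⟩ : ∃ D : ℝ, 0 < D ∧ ∀ x ∈ K, ∀ y ∈ K, dist x y < D := by
    obtain ⟨D, hD⟩ := Metric.isBounded_iff.1 hK.2.1.isBounded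
    exact ⟨max D 0 + 1, by positivity, fun x hx y hy =>
      lt_of_le_of_lt ((hD hx hy).trans (le_max_left _ _)) (lt_add_one _)⟩
  have hone : ∀ x ∈ K, ∀ ρ : ℝ, D ≤ ρ → μ (Metric.ball x ρ) = 1 := by
    intro x hx ρ hρ
    rw [← prob_compl_eq_zero_iff measurableSet_ball]
    refine measure_mono_null (t := Kᶜ) (fun y hy hyK => hy ?_) hμK
    exact (hD y hyK x hx).trans_le hρ
  -- Zooming in ends when the ball contains `K`; the last zoom overshoots by at most the smallest
  -- ratio, hence the factor `a`.
  have key : ∀ n : ℕ, ∀ x ∈ K, ∀ ρ : ℝ, 0 < ρ → ρ ≤ D → D * b ^ n ≤ ρ →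
      ENNReal.ofReal ((a * ρ / D) ^ t) ≤ μ (Metric.ball x ρ) := by
    intro n
    induction n with
    | zero =>
      intro x hx ρ hρ0 hρD hn
      rw [hone x hx ρ (by simpa using hn)]
      refine ENNReal.ofReal_le_one.2 (Real.rpow_le_one (by positivity) ?_ ht)
      rw [div_le_one hD0]
      nlinarith
    | succ n ih =>
      intro x hx ρ hρ0 hρD hn
      rw [hK.2.2] at hx
      obtain ⟨i, x', hx', rfl⟩ := Set.mem_iUnion.1 hx
      have hri := Λ.ratio_pos i
      have hle : ENNReal.ofReal (Λ.ratio i ^ t) * μ (Metric.ball x' (ρ / Λ.ratio i))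
          ≤ μ (Metric.ball (Λ.map i x') ρ) := by
        rw [h.measure_eq (A := Metric.ball (Λ.map i x') ρ) measurableSet_ball,
          ← preimage_map_ball]
        exact Finset.single_le_sum (f := fun j => ENNReal.ofReal (Λ.ratio j ^ t) *
          μ (Λ.map j ⁻¹' Metric.ball (Λ.map i x') ρ)) (fun _ _ => zero_le) (Finset.mem_univ i)
      refine le_trans ?_ hle
      rcases le_total D (ρ / Λ.ratio i) with h1 | h1
      · rw [hone x' hx' _ h1, mul_one]
        apply ENNReal.ofReal_le_ofReal
        refine Real.rpow_le_rpow (by positivity) ?_ ht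
        refine le_trans ?_ (hab i).1
        rw [div_le_iff₀ hD0]
        gcongr
      · refine le_trans ?_ (mul_le_mul_right (ih x' hx' (ρ / Λ.ratio i) (by positivity) h1 ?_) _)
        · rw [← ENNReal.ofReal_mul (by positivity), ← Real.mul_rpow hri.le (by positivity)]
          apply le_of_eq
          congr 2
          field_simp
        · rw [le_div_iff₀ hri]
          calc D * b ^ n * Λ.ratio i ≤ D * b ^ n * b := by
                gcongr
                exact (hab i).2
            _ = D * b ^ (n + 1) := by ring
            _ ≤ ρ := hn
  refine ⟨min 1 ((a / D) ^ t), by positivity, fun x hx ρ hρ0 hρ1 => ?_⟩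
  rcases le_total D ρ with h1 | h1
  · rw [hone x hx ρ h1]
    refine ENNReal.ofReal_le_one.2 (mul_le_one₀ (min_le_left _ _) (by positivity) ?_)
    exact Real.rpow_le_one hρ0.le hρ1 ht
  · obtain ⟨n, hn⟩ := exists_pow_lt_of_lt_one (show 0 < ρ / D by positivity) hb1
    rw [lt_div_iff₀' hD0] at hn
    refine le_trans (ENNReal.ofReal_le_ofReal ?_) (key n x hx ρ hρ0 h1 hn.le)
    rw [mul_div_right_comm, Real.mul_rpow (by positivity) hρ0.le]
    gcongr
    exact min_le_right _ _

/-- Natural measures of separated systems are AD-regular with `κ₂` at least the dimension. -/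
theorem IsStationary.isADRegular_and_le_kappaTwo
    (h : Λ.IsStationary (fun i => Λ.ratio i ^ t) μ) (ht : 0 ≤ t)
    (hK : Λ.IsAttractor K) (hμK : μ Kᶜ = 0)
    (hsep : Pairwise fun i j => Disjoint (Λ.map i '' K) (Λ.map j '' K)) :
    IsADRegular μ ∧ ∀ s : ℝ, 0 ≤ s → s < k → s ≤ t → s ≤ kappaTwo μ := by
  have := h.1
  obtain ⟨δ, hδ0, hδ⟩ := exists_gap hK.2.1 hsep
  obtain ⟨c, hc0, hc⟩ := h.le_measure_ball ht hK hμK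
  have hsub : μ.support ⊆ K := Measure.support_subset_of_isClosed hK.2.1.isClosed
    (by rw [mem_ae_iff]; exact hμK)
  set C := max 1 (max (δ⁻¹ ^ t) c⁻¹) with hC
  have hC1 : 1 ≤ C := le_max_left _ _
  have hup : ∀ x ∈ K, ∀ r : ℝ, 0 < r → μ.real (Metric.ball x r) ≤ C * r ^ t := by
    intro x hx r hr
    refine ENNReal.toReal_le_of_le_ofReal (by positivity) ((h.measure_ball_le ht hK hμK hδ0 hδ hx
      hr).trans (ENNReal.ofReal_le_ofReal ?_))
    rw [div_eq_inv_mul, Real.mul_rpow (by positivity) hr.le]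
    gcongr
    exact (le_max_left _ _).trans (le_max_right _ _)
  refine ⟨⟨t, C, ht, hC1, fun x hx r hr hr1 => ⟨?_, hup x (hsub hx) r hr⟩⟩, fun s hs0 hsk hst => ?_⟩
  · have h1 := hc x (hsub hx) r hr hr1
    rw [ENNReal.ofReal_le_iff_le_toReal (measure_ne_top _ _)] at h1
    refine le_trans ?_ h1
    gcongr
    exact inv_le_of_inv_le₀ hc0 ((le_max_right _ _).trans (le_max_right _ _))
  · refine le_kappaTwo_of_ball_upper_bound μ (A := C) hs0 hsk ?_
    have hae : ∀ᵐ x ∂μ, x ∈ K := by rw [ae_iff]; exact hμK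
    filter_upwards [hae] with x hx r hr
    refine measure_ball_le_of_le_one μ hs0 hC1 (fun r hr hr1 => (hup x hx r hr).trans ?_) hr
    exact mul_le_mul_of_nonneg_left (Real.rpow_le_rpow_of_exponent_ge hr hr1 hst) (by linarith)

end Separated

end SelfSimilarIFS

/-! ### Extracting a separated subsystem. -/

theorem exists_sum_rpow_eq_one {ι : Type*} (W : Finset ι) {r : ι → ℝ} (hr0 : ∀ i ∈ W, 0 < r i)
    (hr1 : ∀ i ∈ W, r i < 1) {t : ℝ} (ht : 1 < ∑ i ∈ W, r i ^ t) :
    ∃ t' : ℝ, t < t' ∧ ∑ i ∈ W, r i ^ t' = 1 := by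
  have hlim : Tendsto (fun s : ℝ => ∑ i ∈ W, r i ^ s) atTop (𝓝 0) := by
    have := tendsto_finsetSum W fun i hi =>
      tendsto_rpow_atTop_of_base_lt_one (r i) (by linarith [hr0 i hi]) (hr1 i hi)
    simpa using this
  obtain ⟨s, hs1, hst⟩ := ((hlim.eventually_lt_const one_pos).and (eventually_gt_atTop t)).exists
  have hcont : ContinuousOn (fun s : ℝ => ∑ i ∈ W, r i ^ s) (Set.Icc t s) :=
    continuousOn_finsetSum _ fun i hi =>
      (Real.continuous_const_rpow (hr0 i hi).ne').continuousOn
  obtain ⟨t', ht', h⟩ := intermediate_value_Icc' hst.le hcont ⟨hs1.le, ht.le⟩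
  refine ⟨t', lt_of_le_of_ne ht'.1 ?_, h⟩
  rintro rfl
  exact ht.ne' h

/-- `n` factors from `F'` are at most `n * l` factors from `F`, so the rate for `F` is taken as `ε /
(l + 1)`. -/
theorem NonExpanding.of_mem_pow {G : Type*} [Group G] {F F' : Set G} (hF : NonExpanding F)
    (hF' : F'.Finite) {l : ℕ} (h : ∀ g ∈ F', ∃ m ≤ l, g ∈ F ^ m) : NonExpanding F' := by
  refine ⟨hF', fun ε hε => ?_⟩
  have hpow : ∀ n : ℕ, ∀ g ∈ F' ^ n, ∃ m ≤ n * l, g ∈ F ^ m := by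
    intro n
    induction n with
    | zero => exact fun g hg => ⟨0, by simp, by simpa using hg⟩
    | succ n ih =>
      intro g hg
      rw [pow_succ] at hg
      obtain ⟨g₁, hg₁, g₂, hg₂, rfl⟩ := Set.mem_mul.1 hg
      obtain ⟨m₁, hm₁, h₁⟩ := ih g₁ hg₁
      obtain ⟨m₂, hm₂, h₂⟩ := h g₂ hg₂
      refine ⟨m₁ + m₂, by rw [add_mul, one_mul]; exact add_le_add hm₁ hm₂, ?_⟩
      rw [pow_add]
      exact Set.mul_mem_mul h₁ h₂
  obtain ⟨C, hC0, hC⟩ := hF.exists_finset_card_le (show 0 < ε / (l + 1) by positivity)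
  refine ⟨C, fun n => ?_⟩
  obtain ⟨T, hT, hcard⟩ := hC (n * l)
  have hsub : F' ^ n ⊆ (T : Set G) := fun g hg => by
    obtain ⟨m, hm, hgm⟩ := hpow n g hg
    exact hT m hm hgm
  have h1 : ((F' ^ n).ncard : ℝ) ≤ T.card := by
    rw [← Set.ncard_coe_finset]
    exact_mod_cast Set.ncard_le_ncard hsub T.finite_toSet
  refine h1.trans (hcard.trans ?_)
  refine mul_le_mul_of_nonneg_left (Real.exp_le_exp.2 ?_) hC0
  push_cast
  rw [div_mul_eq_mul_div, div_le_iff₀ (by positivity)]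
  have : (0 : ℝ) ≤ ε * n := by positivity
  nlinarith

namespace SelfSimilarIFS

variable {k N : ℕ} (Λ : SelfSimilarIFS k N)

/-- A cover of the attractor by balls around a disjoint family of cylinders of comparable size. -/
theorem exists_disjoint_cover {E : Set (EuclideanSpace ℝ (Fin k))} (hE : Λ.IsAttractor E)
    {a D : ℝ} (ha0 : 0 < a) (ha1 : a ≤ 1) (ha : ∀ i, a ≤ Λ.ratio i)
    (hD : ∀ x ∈ E, ∀ y ∈ E, dist x y ≤ D) {x₀ : EuclideanSpace ℝ (Fin k)} (hx₀ : x₀ ∈ E)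
    {r : ℝ} (hr0 : 0 < r) (hr1 : r ≤ 1) :
    ∃ W : Finset (List (Fin N)), (∀ w ∈ W, a * r ≤ Λ.wordRatio w ∧ Λ.wordRatio w ≤ r) ∧
      (W : Set (List (Fin N))).PairwiseDisjoint (fun w => Λ.wordMap w '' E) ∧
      E ⊆ ⋃ w : W, Metric.closedBall (Λ.wordMap w x₀) (2 * (D * r)) := by
  classical
  obtain ⟨_, b, -, -, hb0, hb1, hab⟩ := Λ.exists_ratio_bounds
  obtain ⟨n, hn⟩ := exists_pow_lt_of_lt_one hr0 hb1
  have hmem : ∀ w ∈ Λ.stopping r n, a * r ≤ Λ.wordRatio w ∧ Λ.wordRatio w ≤ r := fun w hw =>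
    ⟨(Λ.mem_stopping hr1 ha ha0 ha1 w hw).2.1,
      Λ.wordRatio_le_of_mem_stopping hr1 ha ha0 ha1 (fun i => (hab i).2) hn.le hw⟩
  have hD0 : 0 ≤ D := dist_nonneg.trans (hD x₀ hx₀ x₀ hx₀)
  have hdiam : ∀ w ∈ Λ.stopping r n, ∀ x ∈ E, ∀ y ∈ E,
      dist (Λ.wordMap w x) (Λ.wordMap w y) ≤ D * r := by
    intro w hw x hx y hy
    rw [dist_wordMap, mul_comm]
    exact mul_le_mul (hD x hx y hy) (hmem w hw).2 (Λ.wordRatio_pos w).le hD0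
  -- A disjoint family of largest cardinality: every other stopped cylinder meets a chosen one,
  -- hence lies within two diameters of its marked point.
  set 𝒲 := ((Λ.stopping r n).toFinset.powerset).filter fun W : Finset (List (Fin N)) =>
    (W : Set (List (Fin N))).PairwiseDisjoint fun w => Λ.wordMap w '' E with h𝒲
  obtain ⟨W, hW, hmax⟩ := Finset.exists_max_image 𝒲 Finset.card
    ⟨∅, by simp [h𝒲]⟩
  rw [h𝒲, Finset.mem_filter, Finset.mem_powerset] at hW
  have hWs : ∀ w ∈ W, w ∈ Λ.stopping r n := fun w hw => Multiset.mem_toFinset.1 (hW.1 hw)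
  refine ⟨W, fun w hw => hmem w (hWs w hw), hW.2, fun x hx => ?_⟩
  obtain ⟨w, hw, y, hy, rfl⟩ := Λ.exists_mem_stopping hE.2.2 r n hx
  obtain ⟨v, hv, hvw⟩ : ∃ v ∈ W, ¬ Disjoint (Λ.wordMap w '' E) (Λ.wordMap v '' E) := by
    by_contra! hcon
    have hwW : w ∉ W := fun h => by
      have := hcon w h
      rw [disjoint_self] at this
      exact (hE.1.image (Λ.wordMap w)).ne_empty this
    have := hmax (insert w W) (by
      rw [h𝒲, Finset.mem_filter, Finset.mem_powerset, Finset.coe_insert]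
      refine ⟨Finset.insert_subset (Multiset.mem_toFinset.2 hw) hW.1, ?_⟩
      exact hW.2.insert fun v hv _ => hcon v hv)
    rw [Finset.card_insert_of_notMem hwW] at this
    omega
  obtain ⟨z, ⟨z₁, hz₁, rfl⟩, z₂, hz₂, hz⟩ := Set.not_disjoint_iff.1 hvw
  refine Set.mem_iUnion.2 ⟨⟨v, hv⟩, ?_⟩
  rw [Metric.mem_closedBall]
  calc dist (Λ.wordMap w y) (Λ.wordMap v x₀)
      ≤ dist (Λ.wordMap w y) (Λ.wordMap w z₁) + dist (Λ.wordMap w z₁) (Λ.wordMap v x₀) :=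
        dist_triangle _ _ _
    _ ≤ D * r + D * r := by
        refine add_le_add (hdiam w hw y hy z₁ hz₁) ?_
        rw [← hz]
        exact hdiam v (hWs v hv) z₂ hz₂ x₀ hx₀
    _ = 2 * (D * r) := by ring

/-- Below the Hausdorff dimension of the attractor there are disjoint cylinders carrying more than
unit mass. -/
theorem exists_disjoint_words {E : Set (EuclideanSpace ℝ (Fin k))} (hE : Λ.IsAttractor E)
    {t : NNReal} (ht : (t : ℝ≥0∞) < dimH E) :
    ∃ W : Finset (List (Fin N)), (∀ w ∈ W, Λ.wordRatio w < 1) ∧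
      (W : Set (List (Fin N))).PairwiseDisjoint (fun w => Λ.wordMap w '' E) ∧
      1 < ∑ w ∈ W, Λ.wordRatio w ^ (t : ℝ) := by
  obtain ⟨a, _, ha0, ha1, -, -, hab⟩ := Λ.exists_ratio_bounds
  obtain ⟨x₀, hx₀⟩ := hE.1
  obtain ⟨D, hD⟩ := Metric.isBounded_iff.1 hE.2.1.isBounded
  have hD0 : 0 ≤ D := dist_nonneg.trans (hD hx₀ hx₀)
  set r : ℕ → ℝ := fun m => 1 / ((m : ℝ) + 2) with hr
  have hr0 : ∀ m, 0 < r m := fun m => by positivity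
  have hr1 : ∀ m, r m < 1 := fun m => by
    rw [hr, div_lt_one (by positivity)]
    linarith [(Nat.cast_nonneg m : (0 : ℝ) ≤ m)]
  have hrlim : Tendsto (fun m => ENNReal.ofReal (4 * D * r m)) atTop (𝓝 0) := by
    have h1 : Tendsto r atTop (𝓝 0) :=
      tendsto_const_nhds.div_atTop (tendsto_atTop_add_const_right _ _ tendsto_natCast_atTop_atTop)
    have := ENNReal.tendsto_ofReal (h1.const_mul (4 * D))
    simpa using this
  choose W hW hdisj hcover using fun m => Λ.exists_disjoint_cover hE ha0 ha1 (fun i => (hab i).1)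
    (fun x hx y hy => hD hx hy) hx₀ (hr0 m) (hr1 m).le
  -- If every disjoint family has `t`-sum at most `1`, the covers at scales `r m → 0` have bounded
  -- `t`-sums, so `μH[t] E < ⊤`, contrary to `t < dimH E`.
  by_contra! hcon
  have hsum : ∀ m, ∑ w ∈ W m, Λ.wordRatio w ^ (t : ℝ) ≤ 1 := fun m =>
    hcon (W m) (fun w hw => (hW m w hw).2.trans_lt (hr1 m)) (hdisj m)
  have hed : ∀ m, ∀ w : W m, Metric.ediam (Metric.closedBall (Λ.wordMap w x₀) (2 * (D * r m)))
      ≤ ENNReal.ofReal (4 * D * r m) := by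
    intro m w
    refine Metric.ediam_le_of_forall_dist_le fun x hx y hy => ?_
    have := dist_triangle_right x y (Λ.wordMap w x₀)
    rw [Metric.mem_closedBall] at hx hy
    linarith
  have hbound : ∀ m, ∑ w : W m, Metric.ediam (Metric.closedBall (Λ.wordMap w x₀) (2 * (D * r m)))
      ^ (t : ℝ) ≤ ENNReal.ofReal ((4 * D / a) ^ (t : ℝ)) := by
    intro m
    calc _ ≤ ∑ _w : W m, ENNReal.ofReal ((4 * D * r m) ^ (t : ℝ)) := by
          refine Finset.sum_le_sum fun w _ => ?_
          rw [← ENNReal.ofReal_rpow_of_nonneg (by have := hr0 m; positivity) t.coe_nonneg]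
          exact ENNReal.rpow_le_rpow (hed m w) t.coe_nonneg
      _ = ENNReal.ofReal ((4 * D / a) ^ (t : ℝ) * ((W m).card * (a * r m) ^ (t : ℝ))) := by
          rw [Finset.sum_const, nsmul_eq_mul, Finset.card_univ, Fintype.card_coe,
            ← ENNReal.ofReal_natCast, ← ENNReal.ofReal_mul (by positivity)]
          have h1 : 4 * D * r m = 4 * D / a * (a * r m) := by field_simp
          rw [h1, Real.mul_rpow (by positivity) (by have := hr0 m; positivity)]
          congr 1
          ring
      _ ≤ ENNReal.ofReal ((4 * D / a) ^ (t : ℝ)) := by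
          apply ENNReal.ofReal_le_ofReal
          refine mul_le_of_le_one_right (by positivity) (le_trans ?_ (hsum m))
          rw [← nsmul_eq_mul, ← Finset.sum_const]
          refine Finset.sum_le_sum fun w hw => ?_
          exact Real.rpow_le_rpow (by have := hr0 m; positivity) (hW m w hw).1 t.2
  have hfin : μH[(t : ℝ)] E ≤ ENNReal.ofReal ((4 * D / a) ^ (t : ℝ)) := by
    refine (Measure.hausdorffMeasure_le_liminf_sum (t : ℝ) E _ hrlim
      (fun m (w : W m) => Metric.closedBall (Λ.wordMap w x₀) (2 * (D * r m)))
      (.of_forall hed) (.of_forall hcover)).trans ?_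
    refine (liminf_le_liminf (.of_forall hbound)).trans ?_
    rw [liminf_const]
  rw [hausdorffMeasure_of_lt_dimH ht] at hfin
  exact ENNReal.ofReal_ne_top (top_le_iff.1 hfin)

/-- Otherwise the word would send a nearest point of `E` to a strictly nearer one. -/
theorem mem_of_wordMap_eq {E : Set (EuclideanSpace ℝ (Fin k))} (hE : Λ.IsAttractor E)
    {w : List (Fin N)} (hw : Λ.wordRatio w < 1) {x : EuclideanSpace ℝ (Fin k)}
    (hx : Λ.wordMap w x = x) : x ∈ E := by
  obtain ⟨y, hy, hxy⟩ := hE.2.1.exists_infDist_eq_dist hE.1 x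
  have h1 : Metric.infDist x E ≤ dist x (Λ.wordMap w y) :=
    Metric.infDist_le_dist_of_mem (Λ.mapsTo_wordMap hE.mapsTo w hy)
  have h2 : dist x (Λ.wordMap w y) = Λ.wordRatio w * dist x y := by
    rw [← dist_wordMap, hx]
  rw [hxy, h2] at h1
  have h3 : dist x y = 0 := by
    by_contra h
    have : 0 < dist x y := lt_of_le_of_ne dist_nonneg (Ne.symm h)
    nlinarith
  rw [dist_eq_zero] at h3
  exact h3 ▸ hy

/-- The subsystem generated by finitely many words with disjoint cylinders. -/
theorem exists_subsystem {E : Set (EuclideanSpace ℝ (Fin k))} (hE : Λ.IsAttractor E) {M : ℕ}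
    (hM : 1 < M) (w : Fin M → List (Fin N)) (hw : ∀ j, Λ.wordRatio (w j) < 1)
    (hdisj : Pairwise fun i j => Disjoint (Λ.wordMap (w i) '' E) (Λ.wordMap (w j) '' E)) :
    ∃ Λ' : SelfSimilarIFS k M, (∀ j, Λ'.ratio j = Λ.wordRatio (w j)) ∧
      (∀ j, Λ'.rot j = Λ.wordRot (w j)) ∧ ∀ j, Λ'.map j = Λ.wordMap (w j) := by
  have hmap : ∀ j x, Λ.wordRatio (w j) • Λ.wordRot (w j) x + Λ.wordMap (w j) 0
      = Λ.wordMap (w j) x := by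
    intro j x
    have := Λ.wordMap_sub_wordMap (w j) 0 x
    rw [sub_zero] at this
    rw [← this, sub_add_cancel]
  refine ⟨⟨hM, fun j => Λ.wordRatio (w j), fun j => Λ.wordRot (w j), fun j => Λ.wordMap (w j) 0,
    fun j => Λ.wordRatio_pos _, hw, ?_⟩, fun _ => rfl, fun _ => rfl, fun j => funext (hmap j)⟩
  -- A common fixed point would lie in `E`, hence in two disjoint cylinders.
  rintro ⟨x, hx⟩
  simp only [hmap] at hx
  have hxE : x ∈ E := Λ.mem_of_wordMap_eq hE (hw ⟨0, by omega⟩) (hx ⟨0, by omega⟩)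
  refine Set.disjoint_left.1 (hdisj (i := ⟨0, by omega⟩) (j := ⟨1, hM⟩) (by simp)) ⟨x, hxE, hx _⟩
    ⟨x, hxE, hx _⟩

theorem IsNonExpanding.of_rot_eq_wordRot {Λ : SelfSimilarIFS k N} (hΛ : Λ.IsNonExpanding) {M : ℕ}
    {Λ' : SelfSimilarIFS k M} {w : Fin M → List (Fin N)} (h : ∀ j, Λ'.rot j = Λ.wordRot (w j)) :
    Λ'.IsNonExpanding := by
  refine NonExpanding.of_mem_pow hΛ (Set.finite_range _)
    (l := Finset.univ.sup fun j => (w j).length) ?_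
  rintro _ ⟨j, rfl⟩
  exact ⟨(w j).length, Finset.le_sup (f := fun j => (w j).length) (Finset.mem_univ j),
    h j ▸ Λ.wordRot_mem_pow (w j)⟩

end SelfSimilarIFS

/-- A non-expanding self-similar set of dimension above `t` carries AD-regular non-expanding
self-similar measures of large `κ₂`. -/
theorem IsNonExpandingSelfSimilarSet.exists_measure {k : ℕ}
    {E : Set (EuclideanSpace ℝ (Fin k))} (hE : IsNonExpandingSelfSimilarSet E) {t : NNReal}
    (ht : (t : ℝ≥0∞) < dimH E) :
    ∃ μ : Measure (EuclideanSpace ℝ (Fin k)), IsADRegular μ ∧ IsNonExpandingSelfSimilarMeasure μ ∧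
      μ E = 1 ∧ ∀ s : ℝ, 0 ≤ s → s < k → s ≤ t → s ≤ kappaTwo μ := by
  obtain ⟨N, Λ, hΛ, hE⟩ := hE
  obtain ⟨W, hW1, hdisj, hsum⟩ := Λ.exists_disjoint_words hE ht
  obtain ⟨t', htt', ht'⟩ := exists_sum_rpow_eq_one W (fun w _ => Λ.wordRatio_pos w) hW1 hsum
  have ht'0 : 0 < t' := lt_of_le_of_lt t.2 htt'
  -- One ratio below `1` raised to the positive power `t'` cannot equal `1`.
  have hM : 1 < W.card := by
    by_contra! hcard
    rcases Finset.card_le_one_iff_subset_singleton.1 hcard with ⟨w, hw⟩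
    rcases Finset.subset_singleton_iff.1 hw with rfl | rfl
    · simp at ht'
    · rw [Finset.sum_singleton] at ht'
      exact (Real.rpow_lt_one (Λ.wordRatio_pos w).le (hW1 w (by simp)) ht'0).ne ht'
  set w : Fin W.card → List (Fin N) := fun j => W.equivFin.symm j with hw
  have hwW : ∀ j, w j ∈ W := fun j => (W.equivFin.symm j).2
  have hwinj : Function.Injective w := Subtype.val_injective.comp W.equivFin.symm.injective
  have hdisj' : Pairwise fun i j => Disjoint (Λ.wordMap (w i) '' E) (Λ.wordMap (w j) '' E) :=
    fun i j hij => hdisj (hwW i) (hwW j) (hwinj.ne hij)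
  obtain ⟨Λ', hratio, hrot, hmap⟩ := Λ.exists_subsystem hE hM w (fun j => hW1 _ (hwW j)) hdisj'
  have hsum' : ∑ j, Λ'.ratio j ^ t' = 1 := by
    rw [← ht', ← Finset.sum_coe_sort W]
    simp only [hratio]
    exact Equiv.sum_comp W.equivFin.symm fun v : W => Λ.wordRatio v ^ t'
  obtain ⟨K, μ, hKE, hK, hμK, hμ⟩ := Λ'.exists_isStationary hE.2.1.isClosed hE.1
    (fun j => by rw [hmap]; exact Λ.mapsTo_wordMap hE.mapsTo (w j))
    (p := fun j => Λ'.ratio j ^ t') (fun j => Real.rpow_nonneg (Λ'.ratio_pos j).le _) hsum'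
  obtain ⟨hAD, hκ⟩ := hμ.isADRegular_and_le_kappaTwo ht'0.le hK hμK fun i j hij => by
    simp only [hmap]
    exact (hdisj' hij).mono (Set.image_mono hKE) (Set.image_mono hKE)
  have := hμ.1
  refine ⟨μ, hAD, ⟨_, Λ', _, hΛ.of_rot_eq_wordRot hrot, fun j => ⟨Real.rpow_pos_of_pos
    (Λ'.ratio_pos j) _, Real.rpow_lt_one (Λ'.ratio_pos j).le (Λ'.ratio_lt_one j) ht'0⟩, hsum', hμ⟩,
    ?_, fun s hs0 hsk hst => hκ s hs0 hsk (hst.trans htt'.le)⟩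
  rw [← prob_compl_eq_zero_iff hE.2.1.measurableSet]
  exact measure_mono_null (Set.compl_subset_compl.2 hKE) hμK

/-! ### Conclusion. -/

theorem HasL2Density.absolutelyContinuous {ν : Measure ℝ} (h : HasL2Density ν) : ν ≪ volume := by
  obtain ⟨g, -, -, rfl⟩ := h
  exact withDensity_absolutelyContinuous _ _

theorem theorem4 (k : ℕ) (hk : 5 ≤ k) (f : EuclideanSpace ℝ (Fin k) → ℝ)
    (hf : ContDiff ℝ ∞ f) (hH : ∀ x, (hessianMatrix f x).det ≠ 0) :
    (∀ μ : Measure (EuclideanSpace ℝ (Fin k)), IsADRegular μ →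
      IsNonExpandingSelfSimilarMeasure μ → 2 + (k : ℝ) / 2 < kappaTwo μ →
      HasL2Density (μ.map f)) ∧
    (∀ E : Set (EuclideanSpace ℝ (Fin k)), IsNonExpandingSelfSimilarSet E →
      2 + (k : ℝ≥0∞) / 2 < dimH E → 0 < volume (f '' E)) := by
  have hmain : ∀ μ : Measure (EuclideanSpace ℝ (Fin k)), IsADRegular μ →
      IsNonExpandingSelfSimilarMeasure μ → 2 + (k : ℝ) / 2 < kappaTwo μ →
      HasL2Density (μ.map f) := fun μ hAD hμ hκ => hasL2Density_map_of_kappaTwo hf hH hAD hμ hκ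
  refine ⟨hmain, fun E hE hdim => ?_⟩
  obtain ⟨t, ht, htE⟩ := ENNReal.lt_iff_exists_nnreal_btwn.1 hdim
  have htr : 2 + (k : ℝ) / 2 < t := by
    have h1 : (2 + (k : ℝ≥0∞) / 2) = ((2 + (k : NNReal) / 2 : NNReal) : ℝ≥0∞) := by
      rw [ENNReal.coe_add, ENNReal.coe_div two_ne_zero]
      simp
    rw [h1, ENNReal.coe_lt_coe, ← NNReal.coe_lt_coe] at ht
    simpa using ht
  obtain ⟨μ, hAD, hμ, hμE, hκ⟩ := hE.exists_measure htE
  have hk5 : (5 : ℝ) ≤ k := by exact_mod_cast hk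
  have hκ' : 2 + (k : ℝ) / 2 < kappaTwo μ := by
    -- The supremum in `kappaTwo` runs over `s < k`, so `t` is capped by the midpoint of `2 + k/2`
    -- and `k`, which lies strictly between them as `k > 4`.
    refine lt_of_lt_of_le (lt_min htr (c := (2 + (k : ℝ) / 2 + k) / 2) (by linarith)) (hκ _ ?_ ?_
      (min_le_left _ _))
    · exact le_min t.2 (by positivity)
    · exact (min_le_right _ _).trans_lt (by linarith)
  have hac := (hmain μ hAD hμ hκ').absolutelyContinuous
  obtain ⟨_, Λ, -, hEΛ⟩ := hE
  have hcompact : IsCompact (f '' E) := hEΛ.2.1.image hf.continuous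
  refine pos_iff_ne_zero.2 fun h0 => ?_
  have h1 := hac h0
  rw [Measure.map_apply hf.continuous.measurable hcompact.measurableSet] at h1
  have h2 := measure_mono_null (Set.subset_preimage_image f E) h1
  rw [hμE] at h2
  exact one_ne_zero h2
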